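/- A represented space is a set $X$ with a partial surjection $\delta_X:\subseteq\mathbb N^{\mathbb N}\to X$; $p$ is a name of $\delta_X(p)$. Computability of (multivalued, partial) maps between represented spaces means existence of a realizer on names that is computable in the type-two sense. $\mathcal O(X)$ is the space of open sets of the final topology of $\delta_X$, an open set $U$ being represented by (codes of realizers of) its characteristic function into Sierpiński space. $\mathcal K_-(X)$ is the space of saturated compact sets $K$, represented by $\{U\in\mathcal O(X):K\subseteq U\}\in\mathcal O\mathcal O(X)$; $\mathcal A_+(X)$ is the space of closed sets $A$, represented by $\{U\in\mathcal O(X):A\cap U\neq\emptyset\}\in\mathcal O\mathcal O(X)$. $X$ is overt if $X$ is a computable point of $\mathcal A_+(X)$. A map $B:R\to\mathcal O(X)$ is a computable presubbase of $X$ if $B^{\mathsf T}:X\to\mathcal O(R)$, $x\mapsto\{r\in R:x\in B(r)\}$, is a well-defined computable embedding (injective, computable, with computable partial inverse). It covers $X$ if $\bigcup_{r\in R}B(r)=X$. It is a computable prebase if it is a computable presubbase, covers $X$, and there is a computable total multivalued map $Q:\mathcal K_-(R)\rightrightarrows\mathcal A_+(R)$ with $\bigcap_{r\in K}B(r)=\bigcup_{r\in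 A}B(r)$ for all $K\in\mathcal K_-(R)$ and $A\in Q(K)$ (the empty intersection is $X$). It is a computable base if it is a computable prebase and its sets form a base of the topology of $X$. **Proposition.** Let $X,Y$ be represented spaces, $Z\subseteq X$, and let $R,S$ be overt represented spaces. Let $B_X:R\to\mathcal O(X)$ and $B_Y:S\to\mathcal O(Y)$ be computable presubbases that cover $X$ and $Y$, respectively (respectively: computable prebases). Then the following are computable presubbases (respectively: computable prebases), where products, $Y^{\mathbb N}$, the space $S^*$ of finite words, coproducts and subspaces carry their canonical representations: 1. $B_{X\times Y}:R\times S\to\mathcal O(X\times Y)$, $(r,s)\mapsto B_X(r)\times B_Y(s)$. 2. $B_{Y^{\mathbb N}}:S^*\to\mathcal O(Y^{\mathbb N})$, $(s_1,\dots,s_n)\mapsto B_Y(s_1)\times\dots\times B_Y(s_n)\times Y^{\mathbb N}$. 3. $B_Z:R\to\mathcal O(Z)$, $r\mapsto B_X(r)\cap Z$. 4. $B_{X\sqcup Y}:R\sqcup S\to\mathcal O(X\sqcup Y)$, $t\mapsto B_X(t)$ if $t\in R$ and $t\mapsto B_Y(t)$ if $t\in S$. 5. $B_{X\sqcap Y}:R\times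 S\to\mathcal O(X\sqcap Y)$, $(r,s)\mapsto B_X(r)\cap B_Y(s)$, where $X\sqcap Y$ is the set $X\cap Y$ (for $X,Y$ subsets of a common set), a name of a point being a pair of a name of it in $X$ and a name of it in $Y$. If $B_X$ and $B_Y$ are even computable bases, then so is $B_{X\sqcup Y}$. For (3), neither overtness of $R$ nor the covering condition is needed. -/

import Mathlib

open Set Topology

universe u v w

/-- The finite word formed by the first `n` entries of `p`. -/
def initSeg (p : ℕ → ℕ) (n : ℕ) : List ℕ := (List.range n).map p

/-- `F` is computable on `D` in the sense of type-two computability: there is an algorithm that,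
from the position `n` and a finite initial segment of the input `p ∈ D`, produces either
nothing or the value `F p n`, and that does produce it if the initial segment is long enough.
Values of `F` outside `D` are irrelevant, so `F` stands for a partial function defined on `D`. -/
def TypeTwoComputableOn (F : (ℕ → ℕ) → (ℕ → ℕ)) (D : Set (ℕ → ℕ)) : Prop :=
  ∃ φ : List ℕ → ℕ → Option ℕ, Computable₂ φ ∧ ∀ p ∈ D, ∀ n,
    (∃ k, φ (initSeg p k) n = some (F p n)) ∧
    (∀ k v, φ (initSeg p k) n = some v → v = F p n)

/-- A represented space: `IsName p x` is the graph of a partial surjection from Baire space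
`ℕ → ℕ` onto `X`. -/
class RepresentedSpace (X : Type u) where
  IsName : (ℕ → ℕ) → X → Prop
  unique : ∀ {p : ℕ → ℕ} {x y : X}, IsName p x → IsName p y → x = y
  exists_name : ∀ x : X, ∃ p, IsName p x

namespace RepresentedSpace

section Basic

variable {X : Type u} {Y : Type v} [RepresentedSpace X] [RepresentedSpace Y]

/-- A point is computable if it has a computable name. -/
def IsComputablePoint (x : X) : Prop := ∃ p : ℕ → ℕ, Computable p ∧ IsName p x

/-- Computability of a multivalued partial map `f`, whose domain is `{x | (f x).Nonempty}`:
`f` has a computable realizer. -/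
def IsComputableMulti (f : X → Set Y) : Prop :=
  ∃ F : (ℕ → ℕ) → (ℕ → ℕ),
    TypeTwoComputableOn F {p | ∃ x : X, IsName p x ∧ (f x).Nonempty} ∧
    ∀ p x, IsName p x → (f x).Nonempty → ∃ y ∈ f x, IsName (F p) y

/-- Computability of a single-valued total map. -/
def IsComputableMap (f : X → Y) : Prop := IsComputableMulti (fun x => ({f x} : Set Y))

/-- A computable embedding: injective, computable, with computable partial inverse
(defined exactly on the range of `f`). -/
def IsComputableEmbedding (f : X → Y) : Prop :=
  Function.Injective f ∧ IsComputableMap f ∧ IsComputableMulti (fun y => {x : X | f x = y})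

/-- The final topology of a represented space: `U` is open if and only if the set of names of
points of `U` is relatively open in the set of all names. It is deliberately not an instance:
on a product of represented spaces it differs in general from the product topology. -/
@[reducible]
def finalTopology (X : Type u) [RepresentedSpace X] : TopologicalSpace X where
  IsOpen U := ∃ W : Set (ℕ → ℕ), IsOpen W ∧ ∀ p x, IsName p x → (p ∈ W ↔ x ∈ U)
  isOpen_univ := ⟨univ, isOpen_univ, by simp⟩
  isOpen_inter := by
    rintro U V ⟨W, hW, h⟩ ⟨W', hW', h'⟩
    exact ⟨W ∩ W', hW.inter hW', fun p x hp => and_congr (h p x hp) (h' p x hp)⟩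
  isOpen_sUnion := by
    intro s hs
    choose! W hW h using hs
    refine ⟨⋃ U ∈ s, W U, isOpen_biUnion hW, fun p x hp => ?_⟩
    simp only [mem_iUnion, mem_sUnion, exists_prop]
    exact exists_congr fun U => and_congr_right fun hU => h U hU p x hp

theorem exists_agree_subset {W : Set (ℕ → ℕ)} (hW : IsOpen W) {p : ℕ → ℕ} (hp : p ∈ W) :
    ∃ n, ∀ q : ℕ → ℕ, (∀ i < n, q i = p i) → q ∈ W := by
  obtain ⟨I, t, ht, hsub⟩ := isOpen_pi_iff.1 hW p hp
  refine ⟨I.sup id + 1, fun q hq => hsub fun i hi => ?_⟩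
  rw [hq i (Nat.lt_succ_of_le (Finset.le_sup (f := id) hi))]
  exact (ht i hi).2

theorem isOpen_agree (p : ℕ → ℕ) (n : ℕ) : IsOpen {q : ℕ → ℕ | ∀ i < n, q i = p i} := by
  have : {q : ℕ → ℕ | ∀ i < n, q i = p i} = ⋂ i ∈ Finset.range n, {q : ℕ → ℕ | q i = p i} := by
    ext q; simp
  rw [this]
  refine isOpen_biInter_finset fun i _ => ?_
  exact (isOpen_discrete ({p i} : Set ℕ)).preimage (f := fun q : ℕ → ℕ => q i) (continuous_apply i)

theorem finalTopology_isOpen_iff {U : Set X} :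
    IsOpen[finalTopology X] U ↔ ∀ p x, IsName p x → x ∈ U →
      ∃ n, ∀ q y, (∀ i < n, q i = p i) → IsName q y → y ∈ U := by
  constructor
  · rintro ⟨W, hW, h⟩ p x hp hx
    obtain ⟨n, hn⟩ := exists_agree_subset hW ((h p x hp).2 hx)
    exact ⟨n, fun q y hq hy => (h q y hy).1 (hn q hq)⟩
  · intro h
    refine ⟨{p | ∃ n, ∀ q y, (∀ i < n, q i = p i) → IsName q y → y ∈ U}, ?_, ?_⟩
    · rw [isOpen_iff_forall_mem_open]
      rintro p ⟨n, hn⟩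
      refine ⟨_, ?_, isOpen_agree p n, fun i _ => rfl⟩
      intro q hq
      exact ⟨n, fun r y hr hy => hn r y (fun i hi => (hr i hi).trans (hq i hi)) hy⟩
    · intro p x hp
      exact ⟨fun ⟨n, hn⟩ => hn p x (fun _ _ => rfl) hp, fun hx => h p x hp hx⟩

theorem finalTopology_isOpen_preimage {f : X → Y} {F : (ℕ → ℕ) → (ℕ → ℕ)} (hF : Continuous F)
    (h : ∀ p x, IsName p x → IsName (F p) (f x)) {U : Set Y} (hU : IsOpen[finalTopology Y] U) :
    IsOpen[finalTopology X] (f ⁻¹' U) := by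
  obtain ⟨W, hW, hWU⟩ := hU
  exact ⟨F ⁻¹' W, hW.preimage hF, fun p x hp => hWU (F p) (f x) (h p x hp)⟩

end Basic

/-! The hyperspaces of open, compact saturated, and closed sets -/

/-- The set of open subsets of a represented space. -/
@[ext]
structure OpenSets (X : Type u) [RepresentedSpace X] where
  carrier : Set X
  isOpen : IsOpen[finalTopology X] carrier

/-- The set of saturated compact subsets; saturated means equal to the intersection of all
open supersets. -/
@[ext]
structure CompactSets (X : Type u) [RepresentedSpace X] where
  carrier : Set X
  isCompact : @IsCompact X (finalTopology X) carrier
  saturated : ∀ x, (∀ U : OpenSets X, carrier ⊆ U.carrier → x ∈ U.carrier) → x ∈ carrier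

/-- The set of closed subsets. -/
@[ext]
structure ClosedSets (X : Type u) [RepresentedSpace X] where
  carrier : Set X
  isClosed : @IsClosed X (finalTopology X) carrier

section Hyperspaces

variable {X : Type u} [RepresentedSpace X]

theorem initSeg_eq_iff {p q : ℕ → ℕ} {n : ℕ} : initSeg q n = initSeg p n ↔ ∀ i < n, q i = p i := by
  simp [initSeg]

/-- A name of an open set `U` enumerates (with a shift by one, so that nothing need be enumerated)
a set of finite words such that a name of a point `x` has an initial segment among those words
if and only if `x ∈ U`. So it codes a realizer of the characteristic function of `U` with values
in Sierpinski space. -/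
instance : RepresentedSpace (OpenSets X) where
  IsName p U := ∀ q x, IsName q x →
    (x ∈ U.carrier ↔ ∃ k n, p k = Encodable.encode (initSeg q n) + 1)
  unique := by
    intro p U V hU hV
    ext x
    obtain ⟨q, hq⟩ := exists_name x
    rw [hU q x hq, hV q x hq]
  exists_name := by
    classical
    intro U
    obtain ⟨W, hW, h⟩ := U.isOpen
    refine ⟨fun k => if ∃ (q : ℕ → ℕ) (n : ℕ), k = Encodable.encode (initSeg q n) ∧
      ∀ r : ℕ → ℕ, (∀ i < n, r i = q i) → r ∈ W then k + 1 else 0, fun q x hq => ?_⟩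
    rw [← h q x hq]
    constructor
    · intro hqW
      obtain ⟨n, hn⟩ := exists_agree_subset hW hqW
      exact ⟨Encodable.encode (initSeg q n), n, if_pos ⟨q, n, rfl, hn⟩⟩
    · rintro ⟨k, n, hk⟩
      simp only at hk
      split_ifs at hk with hc
      obtain ⟨r, m, hr, hm⟩ := hc
      have hw : initSeg q n = initSeg r m :=
        Encodable.encode_injective ((Nat.succ_injective hk).symm.trans hr)
      have hnm : n = m := by simpa [initSeg] using congrArg List.length hw
      subst hnm
      exact hm q (initSeg_eq_iff.1 hw)

theorem isOpen_setOf_superset {K : Set X} (hK : @IsCompact X (finalTopology X) K) :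
    IsOpen[finalTopology (OpenSets X)] {U : OpenSets X | K ⊆ U.carrier} := by
  rw [finalTopology_isOpen_iff]
  intro p U hp hKU
  by_contra! hcon
  choose q V hq hV hKV using hcon
  let _ : TopologicalSpace X := finalTopology X
  let O : ℕ → Set X := fun k => {x | x ∈ U.carrier ∧ ∀ n ≥ k, x ∈ (V n).carrier}
  have hO : ∀ k, IsOpen (O k) := by
    intro k
    refine finalTopology_isOpen_iff.2 fun s x hs hx => ?_
    obtain ⟨a, b, hab⟩ := (hp s x hs).1 hx.1
    have hfin : IsOpen (⋂ n ∈ Finset.Icc k a, (V n).carrier) :=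
      isOpen_biInter_finset fun n _ => (V n).isOpen
    obtain ⟨m, hm⟩ := finalTopology_isOpen_iff.1 hfin s x hs
      (mem_iInter₂.2 fun n hn => hx.2 n (Finset.mem_Icc.1 hn).1)
    refine ⟨max m b, fun t y ht hy => ?_⟩
    have hseg : initSeg t b = initSeg s b :=
      initSeg_eq_iff.2 fun i hi => ht i (lt_max_of_lt_right hi)
    refine ⟨(hp t y hy).2 ⟨a, b, by rw [hseg, hab]⟩, fun n hn => ?_⟩
    rcases lt_or_ge a n with han | han
    · exact (hV n t y hy).2 ⟨a, b, by rw [hq n a han, hseg, hab]⟩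
    · exact mem_iInter₂.1 (hm t y (fun i hi => ht i (lt_max_of_lt_left hi)) hy) n
        (Finset.mem_Icc.2 ⟨hn, han⟩)
  have hmono : Monotone O := fun k l hkl x hx => ⟨hx.1, fun n hn => hx.2 n (hkl.trans hn)⟩
  have hcov : K ⊆ ⋃ k, O k := by
    intro x hx
    obtain ⟨s, hs⟩ := exists_name x
    obtain ⟨a, b, hab⟩ := (hp s x hs).1 (hKU hx)
    exact mem_iUnion.2 ⟨a + 1, hKU hx, fun n hn =>
      (hV n s x hs).2 ⟨a, b, by rw [hq n a (Nat.lt_of_succ_le hn), hab]⟩⟩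
  obtain ⟨k, hk⟩ := hK.elim_directed_cover O hO hcov hmono.directed_le
  exact hKV k fun x hx => (hk hx).2 k le_rfl

theorem isOpen_setOf_meets (A : Set X) :
    IsOpen[finalTopology (OpenSets X)] {U : OpenSets X | (A ∩ U.carrier).Nonempty} := by
  rw [finalTopology_isOpen_iff]
  rintro p U hp ⟨x, hxA, hxU⟩
  obtain ⟨s, hs⟩ := exists_name x
  obtain ⟨a, b, hab⟩ := (hp s x hs).1 hxU
  exact ⟨a + 1, fun q V hq hV => ⟨x, hxA, (hV s x hs).2 ⟨a, b, by rw [hq a a.lt_succ_self, hab]⟩⟩⟩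

/-- The open set `{U | K ⊆ U}` of open sets. -/
def CompactSets.filter (K : CompactSets X) : OpenSets (OpenSets X) :=
  ⟨{U | K.carrier ⊆ U.carrier}, isOpen_setOf_superset K.isCompact⟩

/-- The open set `{U | A ∩ U ≠ ∅}` of open sets. -/
def ClosedSets.trace (A : ClosedSets X) : OpenSets (OpenSets X) :=
  ⟨{U | (A.carrier ∩ U.carrier).Nonempty}, isOpen_setOf_meets A.carrier⟩

/-- Compact sets are represented by universal quantification over open sets (negative
information). -/
instance : RepresentedSpace (CompactSets X) where
  IsName p K := IsName p K.filter
  unique := by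
    intro p K L hK hL
    have h : ∀ U : OpenSets X, K.carrier ⊆ U.carrier ↔ L.carrier ⊆ U.carrier := fun U =>
      Set.ext_iff.1 (congrArg OpenSets.carrier (unique hK hL)) U
    ext x
    exact ⟨fun hx => L.saturated x fun U hU => (h U).2 hU hx,
      fun hx => K.saturated x fun U hU => (h U).1 hU hx⟩
  exists_name K := exists_name K.filter

/-- Closed sets are represented by existential quantification over open sets (positive
information). -/
instance : RepresentedSpace (ClosedSets X) where
  IsName p A := IsName p A.trace
  unique := by
    intro p A C hA hC
    have h : ∀ U : OpenSets X, (A.carrier ∩ U.carrier).Nonempty ↔ (C.carrier ∩ U.carrier).Nonempty :=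
      fun U => Set.ext_iff.1 (congrArg OpenSets.carrier (unique hA hC)) U
    have key : ∀ {A C : ClosedSets X}, (∀ U : OpenSets X, (A.carrier ∩ U.carrier).Nonempty →
        (C.carrier ∩ U.carrier).Nonempty) → A.carrier ⊆ C.carrier := by
      intro A C h x hx
      by_contra hxC
      obtain ⟨y, hy, hy'⟩ := h ⟨C.carrierᶜ, @IsClosed.isOpen_compl X (finalTopology X) _ C.isClosed⟩
        ⟨x, hx, hxC⟩
      exact hy' hy
    ext x
    exact ⟨fun hx => key (fun U => (h U).1) hx, fun hx => key (fun U => (h U).2) hx⟩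
  exists_name A := exists_name A.trace

end Hyperspaces

/-- A represented space is overt if the whole space is a computable point of the space of its
closed subsets. -/
def IsOvert (X : Type u) [RepresentedSpace X] : Prop :=
  IsComputablePoint (⟨univ, @isClosed_univ X (finalTopology X)⟩ : ClosedSets X)

/-! Presubbases, prebases and bases -/

section Bases

variable {X : Type u} {R : Type v} [RepresentedSpace X] [RepresentedSpace R]

/-- `B` is a computable presubbase: its transpose `x ↦ {r | x ∈ B r}` is a well-defined computable
embedding into the space of open sets of the index space. -/
def IsComputablePresubbase (B : R → OpenSets X) : Prop :=
  ∃ h : ∀ x : X, IsOpen[finalTopology R] {r | x ∈ (B r).carrier},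
    IsComputableEmbedding (fun x : X => (⟨{r | x ∈ (B r).carrier}, h x⟩ : OpenSets R))

/-- The members of the family cover the space. -/
def Covers (B : R → OpenSets X) : Prop := ⋃ r, (B r).carrier = univ

/-- `B` is a computable prebase: a computable presubbase that covers the space and for which
compact intersections can be computed as overt unions (the empty intersection is the whole
space). -/
def IsComputablePrebase (B : R → OpenSets X) : Prop :=
  IsComputablePresubbase B ∧
  (∃ Q : CompactSets R → Set (ClosedSets R), (∀ K, (Q K).Nonempty) ∧ IsComputableMulti Q ∧
    ∀ K, ∀ A ∈ Q K, ⋂ r ∈ K.carrier, (B r).carrier = ⋃ r ∈ A.carrier, (B r).carrier) ∧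
  Covers B

/-- `B` is a computable base: a computable prebase that is a base of the topology. -/
def IsComputableBase (B : R → OpenSets X) : Prop :=
  IsComputablePrebase B ∧
  @TopologicalSpace.IsTopologicalBasis X (finalTopology X) (range fun r => (B r).carrier)

end Bases

/-! Constructions of represented spaces -/

section Constructions

variable {X : Type u} {Y : Type v} [RepresentedSpace X] [RepresentedSpace Y]

/-- The product: a name of `(x, y)` has a name of `x` in its even and a name of `y` in its odd
entries. -/
instance : RepresentedSpace (X × Y) where
  IsName p z := IsName (fun n => p (2 * n)) z.1 ∧ IsName (fun n => p (2 * n + 1)) z.2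
  unique h h' := Prod.ext (unique h.1 h'.1) (unique h.2 h'.2)
  exists_name z := by
    obtain ⟨p, hp⟩ := exists_name z.1
    obtain ⟨q, hq⟩ := exists_name z.2
    refine ⟨fun n => if n % 2 = 0 then p (n / 2) else q (n / 2), ?_, ?_⟩
    · simpa using hp
    · have h1 : ∀ n, (2 * n + 1) % 2 = 1 := fun n => by omega
      have h2 : ∀ n, (2 * n + 1) / 2 = n := fun n => by omega
      simpa [h1, h2] using hq

/-- The countable power: the columns of a name are names of the entries of the sequence. -/
instance : RepresentedSpace (ℕ → Y) where
  IsName p y := ∀ i, IsName (fun k => p (Nat.pair i k)) (y i)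
  unique h h' := funext fun i => unique (h i) (h' i)
  exists_name y := by
    choose p hp using fun i => exists_name (y i)
    exact ⟨fun n => p n.unpair.1 n.unpair.2, fun i => by simpa using hp i⟩

/-- Finite words: a name consists of the length followed by names of the letters. -/
instance : RepresentedSpace (List Y) where
  IsName p l := p 0 = l.length ∧
    ∀ (i : ℕ) (hi : i < l.length), IsName (fun k => p (Nat.pair i k + 1)) l[i]
  unique h h' := List.ext_getElem (h.1.symm.trans h'.1) fun i hi hi' => unique (h.2 i hi) (h'.2 i hi')
  exists_name l := by
    choose p hp using fun i : Fin l.length => exists_name l[i]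
    refine ⟨fun n => Nat.casesOn n l.length fun m =>
      if h : m.unpair.1 < l.length then p ⟨m.unpair.1, h⟩ m.unpair.2 else 0, rfl, fun i hi => ?_⟩
    simpa [hi] using hp ⟨i, hi⟩

/-- A subspace carries the restriction of the representation. -/
instance (Z : Set X) : RepresentedSpace Z where
  IsName p z := IsName p (z : X)
  unique h h' := Subtype.ext (unique h h')
  exists_name z := exists_name (z : X)

/-- The coproduct: the first entry of a name tells the summand, the rest is a name there. -/
instance : RepresentedSpace (X ⊕ Y) where
  IsName p z := Sum.elim (fun x => p 0 = 0 ∧ IsName (fun n => p (n + 1)) x)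
    (fun y => p 0 = 1 ∧ IsName (fun n => p (n + 1)) y) z
  unique := by
    rintro p (x | y) (x' | y') h h'
    · exact congrArg Sum.inl (unique h.2 h'.2)
    · exact absurd (h.1.symm.trans h'.1) zero_ne_one
    · exact absurd (h'.1.symm.trans h.1) zero_ne_one
    · exact congrArg Sum.inr (unique h.2 h'.2)
  exists_name := by
    rintro (x | y)
    · obtain ⟨p, hp⟩ := exists_name x
      exact ⟨fun n => Nat.casesOn n 0 p, rfl, hp⟩
    · obtain ⟨p, hp⟩ := exists_name y
      exact ⟨fun n => Nat.casesOn n 1 p, rfl, hp⟩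

/-- The set `X ∩ Y`, where `X` and `Y` are regarded as subsets of a common set `Ω` through the
injections `i` and `j`. -/
def Meet {Ω : Type w} (i : X ↪ Ω) (j : Y ↪ Ω) : Type w := {z : Ω // z ∈ range i ∩ range j}

/-- The meet: a name of a point consists of a name of it as a point of `X` and a name of it as a
point of `Y`. -/
instance {Ω : Type w} (i : X ↪ Ω) (j : Y ↪ Ω) : RepresentedSpace (Meet i j) where
  IsName p z := (∃ x, i x = z.1 ∧ IsName (fun n => p (2 * n)) x) ∧
    ∃ y, j y = z.1 ∧ IsName (fun n => p (2 * n + 1)) y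
  unique := by
    rintro p z z' ⟨⟨x, hx, hpx⟩, _⟩ ⟨⟨x', hx', hpx'⟩, _⟩
    exact Subtype.ext (by rw [← hx, ← hx', unique hpx hpx'])
  exists_name := by
    rintro ⟨z, ⟨x, hx⟩, ⟨y, hy⟩⟩
    obtain ⟨p, hp⟩ := exists_name (x, y)
    exact ⟨p, ⟨x, hx, hp.1⟩, ⟨y, hy, hp.2⟩⟩

end Constructions

/-! Constructions of open sets -/

section OpenConstructions

variable {X : Type u} {Y : Type v} [RepresentedSpace X] [RepresentedSpace Y]

/-- The product `U × V` of open sets. -/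
def OpenSets.prod (U : OpenSets X) (V : OpenSets Y) : OpenSets (X × Y) where
  carrier := U.carrier ×ˢ V.carrier
  isOpen := @IsOpen.inter (X × Y) (finalTopology (X × Y)) _ _
    (finalTopology_isOpen_preimage (f := Prod.fst) (F := fun p n => p (2 * n))
      (by fun_prop) (fun _ _ (h : IsName _ _ ∧ IsName _ _) => h.1) U.isOpen)
    (finalTopology_isOpen_preimage (f := Prod.snd) (F := fun p n => p (2 * n + 1))
      (by fun_prop) (fun _ _ (h : IsName _ _ ∧ IsName _ _) => h.2) V.isOpen)

/-- The cylinder `U₁ × ⋯ × Uₙ × Y^ℕ`. -/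
def OpenSets.cylinder (l : List (OpenSets Y)) : OpenSets (ℕ → Y) where
  carrier := {y | ∀ (i : ℕ) (hi : i < l.length), y i ∈ l[i].carrier}
  isOpen := by
    let _ : TopologicalSpace (ℕ → Y) := finalTopology (ℕ → Y)
    have h : {y : ℕ → Y | ∀ (i : ℕ) (hi : i < l.length), y i ∈ l[i].carrier} =
        ⋂ i : Fin l.length, (fun y : ℕ → Y => y i) ⁻¹' l[i].carrier := by
      ext y
      simp only [mem_ofPred_eq, mem_iInter, mem_preimage]
      exact ⟨fun h i => h i i.2, fun h i hi => h ⟨i, hi⟩⟩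
    rw [h]
    exact isOpen_iInter_of_finite fun i => finalTopology_isOpen_preimage
      (F := fun p k => p (Nat.pair i k)) (by fun_prop) (fun p y (h : ∀ i, IsName (fun k => p (Nat.pair i k)) (y i)) => h i) l[i].isOpen

/-- The trace `U ∩ Z` on a subspace `Z`. -/
def OpenSets.restrict (U : OpenSets X) (Z : Set X) : OpenSets Z where
  carrier := {z | (z : X) ∈ U.carrier}
  isOpen := finalTopology_isOpen_preimage (f := ((↑) : Z → X)) (F := id)
    continuous_id (fun _ _ h => h) U.isOpen

variable (Y) in
/-- An open set of the first summand, as an open set of the coproduct. -/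
def OpenSets.inl (U : OpenSets X) : OpenSets (X ⊕ Y) where
  carrier := Sum.inl '' U.carrier
  isOpen := by
    obtain ⟨W, hW, h⟩ := U.isOpen
    have h0 : IsOpen {p : ℕ → ℕ | p 0 = 0} :=
      (isOpen_discrete ({0} : Set ℕ)).preimage (f := fun p : ℕ → ℕ => p 0) (continuous_apply 0)
    have h1 : IsOpen ((fun (p : ℕ → ℕ) (n : ℕ) => p (n + 1)) ⁻¹' W) := hW.preimage (by fun_prop)
    refine ⟨_, h0.inter h1, ?_⟩
    rintro p (x | y) hp
    · simpa [hp.1] using h _ x hp.2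
    · simp [hp.1]

variable (X) in
/-- An open set of the second summand, as an open set of the coproduct. -/
def OpenSets.inr (V : OpenSets Y) : OpenSets (X ⊕ Y) where
  carrier := Sum.inr '' V.carrier
  isOpen := by
    obtain ⟨W, hW, h⟩ := V.isOpen
    have h0 : IsOpen {p : ℕ → ℕ | p 0 = 1} :=
      (isOpen_discrete ({1} : Set ℕ)).preimage (f := fun p : ℕ → ℕ => p 0) (continuous_apply 0)
    have h1 : IsOpen ((fun (p : ℕ → ℕ) (n : ℕ) => p (n + 1)) ⁻¹' W) := hW.preimage (by fun_prop)
    refine ⟨_, h0.inter h1, ?_⟩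
    rintro p (x | y) hp
    · simp [hp.1]
    · simpa [hp.1] using h _ y hp.2

/-- The intersection `U ∩ V` in the meet. -/
def OpenSets.meet {Ω : Type w} (i : X ↪ Ω) (j : Y ↪ Ω) (U : OpenSets X) (V : OpenSets Y) :
    OpenSets (Meet i j) where
  carrier := {z | z.1 ∈ i '' U.carrier ∩ j '' V.carrier}
  isOpen := by
    obtain ⟨W, hW, h⟩ := (U.prod V).isOpen
    refine ⟨W, hW, ?_⟩
    rintro p z ⟨⟨x, hx, hpx⟩, ⟨y, hy, hpy⟩⟩
    refine (h p (x, y) ⟨hpx, hpy⟩).trans ⟨fun hxy => ⟨⟨x, hxy.1, hx⟩, ⟨y, hxy.2, hy⟩⟩, ?_⟩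
    rintro ⟨⟨x', hx', hxz⟩, ⟨y', hy', hyz⟩⟩
    obtain rfl := i.injective (hxz.trans hx.symm)
    obtain rfl := j.injective (hyz.trans hy.symm)
    exact ⟨hx', hy'⟩

end OpenConstructions

/-! Constructions of indexed families of open sets -/

section Families

variable {X Y R S : Type*} [RepresentedSpace X] [RepresentedSpace Y]

/-- `(r, s) ↦ B_X(r) × B_Y(s)` -/
def prodFamily (BX : R → OpenSets X) (BY : S → OpenSets Y) : R × S → OpenSets (X × Y) :=
  fun t => (BX t.1).prod (BY t.2)

/-- `(s₁, …, sₙ) ↦ B_Y(s₁) × ⋯ × B_Y(sₙ) × Y^ℕ` -/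
def seqFamily (BY : S → OpenSets Y) : List S → OpenSets (ℕ → Y) :=
  fun l => OpenSets.cylinder (l.map BY)

/-- `r ↦ B_X(r) ∩ Z` -/
def subspaceFamily (BX : R → OpenSets X) (Z : Set X) : R → OpenSets Z :=
  fun r => (BX r).restrict Z

/-- `B_X` on the first and `B_Y` on the second summand of the index space -/
def sumFamily (BX : R → OpenSets X) (BY : S → OpenSets Y) : R ⊕ S → OpenSets (X ⊕ Y) :=
  Sum.elim (fun r => (BX r).inl Y) (fun s => (BY s).inr X)

/-- `(r, s) ↦ B_X(r) ∩ B_Y(s)` -/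
def meetFamily {Ω : Type w} (i : X ↪ Ω) (j : Y ↪ Ω) (BX : R → OpenSets X)
    (BY : S → OpenSets Y) : R × S → OpenSets (Meet i j) :=
  fun t => OpenSets.meet i j (BX t.1) (BY t.2)

end Families

end RepresentedSpace

open RepresentedSpace

namespace RepresentedSpace

/-! Semidecidable relations and computable functionals on Baire space with discrete parameters -/

section Semidecidable

variable {α β γ : Type*} [Primcodable α] [Primcodable β] [Primcodable γ]

/-! Everything is reduced to semidecidable relations between names. A sequence accepts those
sequences that have an initial segment among the words it lists; a name of an open set accepts,
among names of points, exactly those of its own points. Acceptance is semidecidable, and conversely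
a semidecidable relation between `p` and `q` can be curried into a sequence computed from `p` that
accepts the related `q` (`Semidecidable.exists_accepts`).

In this language a presubbase is a family for which `x ∈ B r` is semidecidable in names and a name
of `x` can be read off from any name of `{r | x ∈ B r}` (`isComputablePresubbase_iff`). A prebase
moreover turns "for all `r` in the compact `K`" into "for some `r` in `A`", where meeting `A` is
semidecidable; `K` need not be saturated and `A` need not be closed, because names see only
saturations and closures (`isComputablePrebase_iff`).

For presubbases, the task is to recover each coordinate. By covering, `x ∈ B_X(r)` holds iff some
`s` puts `(x, y)` into `B_X(r) × B_Y(s)`, and overtness of `S` makes this existential quantifier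
semidecidable. In a coproduct, overtness detects which half of the index set is inhabited. In a
power, coordinate `i` is reached by quantifying away the `i` preceding letters
(`exists_iterated_projection`).

For prebases, a compact index set is replaced by its coordinate images
(`exists_namesSupersets_image_rel`), the given operators are applied to these, and the resulting
overt sets are recombined: as a product; as a disjoint union restricted to those summands that
contain all of `K`; or, for powers, as the words with letters in the sets `A i` that are at least as
long as every word in `K`, whose lengths are bounded by compactness. Subspaces and meets have the
names of their ambient space or product, so everything pulls back. -/

theorem initSeg_length (p : ℕ → ℕ) (n : ℕ) : (initSeg p n).length = n := by simp [initSeg]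

theorem initSeg_getD {p : ℕ → ℕ} {n i : ℕ} (h : i < n) : (initSeg p n).getD i 0 = p i := by
  simp [initSeg, h]

theorem eq_initSeg_iff {p : ℕ → ℕ} {w : List ℕ} :
    w = initSeg p w.length ↔ ∀ i < w.length, p i = w.getD i 0 := by
  constructor
  · intro h i hi
    rw [h, initSeg_getD (by simpa using hi)]
  · intro h
    refine List.ext_getElem (initSeg_length _ _).symm fun i hi _ => ?_
    simp [initSeg, h i hi, hi]

theorem initSeg_prefix (p : ℕ → ℕ) {m n : ℕ} (h : m ≤ n) : initSeg p m <+: initSeg p n := by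
  rw [List.prefix_iff_eq_take]
  simp [initSeg, ← List.map_take, List.take_range, h]

/-- `P` is semidecidable: `P p a` holds if and only if it is confirmed by some finite initial
segment of `p`, where confirmation is primitive recursive and monotone. -/
def Semidecidable (P : (ℕ → ℕ) → α → Prop) : Prop :=
  ∃ R : List ℕ × α → Prop, PrimrecPred R ∧ (∀ v w a, v <+: w → R (v, a) → R (w, a)) ∧
    ∀ p a, P p a ↔ ∃ k, R (initSeg p k, a)

/-- A function on Baire space with discrete parameters is computable if its graph is
semidecidable. -/
def ComputableFunctional (F : (ℕ → ℕ) → α → ℕ → ℕ) : Prop :=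
  Semidecidable fun p (b : α × ℕ × ℕ) => F p b.1 b.2.1 = b.2.2

theorem PrimrecPred.exists_mem_option {o : α → Option β} {R : α × β → Prop} (ho : Primrec o)
    (hR : PrimrecPred R) : PrimrecPred fun a => ∃ b, o a = some b ∧ R (a, b) := by
  classical
  refine ⟨inferInstance, (Primrec.option_casesOn ho (Primrec.const false)
    (g := fun a b => decide (R (a, b))) hR.decide).of_eq fun a => ?_⟩
  rcases h : o a with _ | b <;> simp [h]

theorem PrimrecPred.exists_lt_of {S : α × ℕ → Prop} (hS : PrimrecPred S) {f : α → ℕ}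
    (hf : Primrec f) : PrimrecPred fun a => ∃ n < f a, S (a, n) :=
  ((PrimrecRel.exists_mem_list (R := fun n a => S (a, n))
    (hS.comp (Primrec.snd.pair Primrec.fst))).comp
    (Primrec.list_range.comp hf) Primrec.id).of_eq fun a => by simp

theorem PrimrecPred.forall_lt_of {S : α × ℕ → Prop} (hS : PrimrecPred S) {f : α → ℕ}
    (hf : Primrec f) : PrimrecPred fun a => ∀ n < f a, S (a, n) :=
  ((PrimrecRel.forall_mem_list (R := fun n a => S (a, n))
    (hS.comp (Primrec.snd.pair Primrec.fst))).comp
    (Primrec.list_range.comp hf) Primrec.id).of_eq fun a => by simp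

/-! ### Closure properties of semidecidable relations -/

namespace Semidecidable

theorem of_eq {P Q : (ℕ → ℕ) → α → Prop} (hP : Semidecidable P) (h : ∀ p a, P p a ↔ Q p a) :
    Semidecidable Q := by
  obtain rfl : P = Q := funext fun p => funext fun a => propext (h p a)
  exact hP

theorem primrec {S : α → Prop} (hS : PrimrecPred S) :
    Semidecidable fun (_ : ℕ → ℕ) a => S a :=
  ⟨fun x => S x.2, hS.comp Primrec.snd, fun _ _ _ _ h => h, fun _ _ => by simp⟩

theorem lookup : Semidecidable fun p (a : ℕ × ℕ) => p a.1 = a.2 := by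
  refine ⟨fun x => x.1[x.2.1]? = some x.2.2, ?_, ?_, ?_⟩
  · exact Primrec.eq.comp (Primrec.list_getElem?.comp Primrec.fst (Primrec.fst.comp Primrec.snd))
      (Primrec.option_some.comp (Primrec.snd.comp Primrec.snd))
  · rintro v w a ⟨t, rfl⟩ h
    have := (List.getElem?_eq_some_iff.1 h).1
    simp only at h this ⊢
    rwa [List.getElem?_append_left this]
  · intro p a
    constructor
    · intro h
      exact ⟨a.1 + 1, by simp [initSeg, h]⟩
    · rintro ⟨k, hk⟩
      obtain ⟨hlt, h⟩ := List.getElem?_eq_some_iff.1 hk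
      simpa [initSeg] using h

theorem comp {P : (ℕ → ℕ) → β → Prop} (hP : Semidecidable P) {f : α → β} (hf : Primrec f) :
    Semidecidable fun p a => P p (f a) := by
  obtain ⟨R, hR, hm, h⟩ := hP
  exact ⟨fun x => R (x.1, f x.2), hR.comp (Primrec.fst.pair (hf.comp Primrec.snd)),
    fun v w a => hm v w (f a), fun p a => h p (f a)⟩

theorem and {P Q : (ℕ → ℕ) → α → Prop} (hP : Semidecidable P) (hQ : Semidecidable Q) :
    Semidecidable fun p a => P p a ∧ Q p a := by
  obtain ⟨R, hR, hm, h⟩ := hP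
  obtain ⟨R', hR', hm', h'⟩ := hQ
  refine ⟨fun x => R x ∧ R' x, hR.and hR',
    fun v w a hvw hv => ⟨hm v w a hvw hv.1, hm' v w a hvw hv.2⟩, fun p a => ?_⟩
  simp only [h, h']
  constructor
  · rintro ⟨⟨k, hk⟩, l, hl⟩
    exact ⟨max k l, hm _ _ _ (initSeg_prefix p (le_max_left k l)) hk,
      hm' _ _ _ (initSeg_prefix p (le_max_right k l)) hl⟩
  · rintro ⟨k, hk, hl⟩
    exact ⟨⟨k, hk⟩, k, hl⟩

theorem or {P Q : (ℕ → ℕ) → α → Prop} (hP : Semidecidable P) (hQ : Semidecidable Q) :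
    Semidecidable fun p a => P p a ∨ Q p a := by
  obtain ⟨R, hR, hm, h⟩ := hP
  obtain ⟨R', hR', hm', h'⟩ := hQ
  refine ⟨fun x => R x ∨ R' x, hR.or hR',
    fun v w a hvw => Or.imp (hm v w a hvw) (hm' v w a hvw), fun p a => ?_⟩
  simp only [h, h', exists_or]

/-- Dovetailing: the length of the initial segment also bounds the codes of the witnesses tried, so
confirmation stays primitive recursive and monotone. -/
theorem ex {P : (ℕ → ℕ) → α × β → Prop} (hP : Semidecidable P) :
    Semidecidable fun p a => ∃ b, P p (a, b) := by
  obtain ⟨R, hR, hm, h⟩ := hP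
  refine ⟨fun x => ∃ n < x.1.length, ∃ b, Encodable.decode n = some b ∧ R (x.1, x.2, b),
    ?_, ?_, ?_⟩
  · have : PrimrecPred fun y : (List ℕ × α) × ℕ =>
        ∃ b : β, Encodable.decode y.2 = some b ∧ R (y.1.1, y.1.2, b) :=
      PrimrecPred.exists_mem_option
        (R := fun z : ((List ℕ × α) × ℕ) × β => R (z.1.1.1, z.1.1.2, z.2))
        (Primrec.decode.comp Primrec.snd)
        (hR.comp ((Primrec.fst.comp (Primrec.fst.comp Primrec.fst)).pair
          ((Primrec.snd.comp (Primrec.fst.comp Primrec.fst)).pair Primrec.snd)))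
    exact this.exists_lt_of (Primrec.list_length.comp Primrec.fst)
  · rintro v w a hvw ⟨n, hn, b, hb, hr⟩
    exact ⟨n, hn.trans_le hvw.length_le, b, hb, hm _ _ _ hvw hr⟩
  · intro p a
    constructor
    · rintro ⟨b, hb⟩
      obtain ⟨k, hk⟩ := (h p (a, b)).1 hb
      refine ⟨max k (Encodable.encode b + 1), Encodable.encode b, ?_, b, Encodable.encodek b,
        hm _ _ _ (initSeg_prefix p (le_max_left _ _)) hk⟩
      simp [initSeg_length]
    · rintro ⟨k, n, -, b, -, hr⟩
      exact ⟨b, (h p (a, b)).2 ⟨k, hr⟩⟩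

/-- Finitely many confirmations happen on a common initial segment: by monotonicity the longest one
serves for all. -/
theorem exists_uniform {δ : Type*} {R : List ℕ × (δ × ℕ) → Prop}
    (hm : ∀ v w a, v <+: w → R (v, a) → R (w, a)) {p : ℕ → ℕ} {a : δ} {N : ℕ}
    (h : ∀ i < N, ∃ k, R (initSeg p k, a, i)) : ∃ k, ∀ i < N, R (initSeg p k, a, i) := by
  choose! k hk using h
  exact ⟨(Finset.range N).sup k, fun i hi => hm _ _ _
    (initSeg_prefix p (Finset.le_sup (f := k) (Finset.mem_range.2 hi))) (hk i hi)⟩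

theorem forall_lt {P : (ℕ → ℕ) → α × ℕ → Prop} (hP : Semidecidable P) {f : α → ℕ}
    (hf : Primrec f) : Semidecidable fun p a => ∀ i < f a, P p (a, i) := by
  obtain ⟨R, hR, hm, h⟩ := hP
  refine ⟨fun x => ∀ i < f x.2, R (x.1, x.2, i), ?_, ?_, ?_⟩
  · have : PrimrecPred fun y : (List ℕ × α) × ℕ => R (y.1.1, y.1.2, y.2) :=
      hR.comp ((Primrec.fst.comp Primrec.fst).pair
        ((Primrec.snd.comp Primrec.fst).pair Primrec.snd))
    exact this.forall_lt_of (hf.comp Primrec.snd)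
  · exact fun v w a hvw hr i hi => hm _ _ _ hvw (hr i hi)
  · intro p a
    simp only [h]
    exact ⟨exists_uniform hm, fun ⟨k, hk⟩ i hi => ⟨k, hk i hi⟩⟩

end Semidecidable

theorem ComputableFunctional.semidecidable_initSeg {F : (ℕ → ℕ) → α → ℕ → ℕ} (hF : ComputableFunctional F) :
    Semidecidable fun p (b : α × List ℕ) => b.2 = initSeg (F p b.1) b.2.length := by
  have h : Semidecidable fun p (b : (α × List ℕ) × ℕ) => F p b.1.1 b.2 = b.1.2.getD b.2 0 :=
    Semidecidable.comp hF (f := fun b : (α × List ℕ) × ℕ => (b.1.1, b.2, b.1.2.getD b.2 0))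
      ((Primrec.fst.comp Primrec.fst).pair (Primrec.snd.pair
        ((Primrec.list_getD 0).comp (Primrec.snd.comp Primrec.fst) Primrec.snd)))
  exact (h.forall_lt (Primrec.list_length.comp Primrec.snd)).of_eq fun p b => eq_initSeg_iff.symm

/-- A confirmation of `P` reads only a finite part of `F p a`, so it suffices to guess a word,
verify that it is an initial segment of `F p a`, and test it. -/
theorem Semidecidable.subst {P : (ℕ → ℕ) → β → Prop} (hP : Semidecidable P)
    {F : (ℕ → ℕ) → α → ℕ → ℕ} (hF : ComputableFunctional F) {f : α → β} (hf : Primrec f) :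
    Semidecidable fun p a => P (F p a) (f a) := by
  obtain ⟨R, hR, hm, h⟩ := hP
  have h1 : Semidecidable fun (_ : ℕ → ℕ) (b : α × List ℕ) => R (b.2, f b.1) :=
    Semidecidable.primrec (hR.comp (Primrec.snd.pair (hf.comp Primrec.fst)))
  refine (hF.semidecidable_initSeg.and h1).ex.of_eq fun p a => ?_
  rw [h]
  constructor
  · rintro ⟨w, hw, hr⟩
    exact ⟨w.length, by simpa only [← hw] using hr⟩
  · rintro ⟨k, hk⟩
    exact ⟨initSeg (F p a) k, by simp only [initSeg_length], hk⟩

/-! ### Closure properties of computable functionals -/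

namespace ComputableFunctional

theorem lookup {f : α × ℕ → ℕ} {g : (α × ℕ) × ℕ → ℕ} (hf : Primrec f) (hg : Primrec g) :
    ComputableFunctional fun p a n => g ((a, n), p (f (a, n))) := by
  have h1 : Semidecidable fun p (c : (α × ℕ × ℕ) × ℕ) => p (f (c.1.1, c.1.2.1)) = c.2 :=
    Semidecidable.lookup.comp (f := fun c : (α × ℕ × ℕ) × ℕ => (f (c.1.1, c.1.2.1), c.2))
      ((hf.comp ((Primrec.fst.comp Primrec.fst).pair
        (Primrec.fst.comp (Primrec.snd.comp Primrec.fst)))).pair Primrec.snd)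
  have h2 : Semidecidable fun (_ : ℕ → ℕ) (c : (α × ℕ × ℕ) × ℕ) =>
      g ((c.1.1, c.1.2.1), c.2) = c.1.2.2 :=
    Semidecidable.primrec (Primrec.eq.comp (hg.comp (((Primrec.fst.comp Primrec.fst).pair
        (Primrec.fst.comp (Primrec.snd.comp Primrec.fst))).pair Primrec.snd))
        (Primrec.snd.comp (Primrec.snd.comp Primrec.fst)))
  exact (h1.and h2).ex.of_eq fun p a => by simp

theorem proj {f : α × ℕ → ℕ} (hf : Primrec f) : ComputableFunctional fun p a n => p (f (a, n)) :=
  lookup hf Primrec.snd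

protected theorem id : ComputableFunctional fun p (_ : α) => p :=
  proj (f := fun b : α × ℕ => b.2) Primrec.snd

theorem subst {F : (ℕ → ℕ) → β → ℕ → ℕ} (hF : ComputableFunctional F)
    {G : (ℕ → ℕ) → α → ℕ → ℕ} (hG : ComputableFunctional G) {f : α → β} (hf : Primrec f) :
    ComputableFunctional fun p a => F (G p a) (f a) :=
  Semidecidable.subst hF (F := fun p (b : α × ℕ × ℕ) => G p b.1)
    (Semidecidable.comp hG (f := fun c : (α × ℕ × ℕ) × ℕ × ℕ => (c.1.1, c.2))
      ((Primrec.fst.comp Primrec.fst).pair Primrec.snd))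
    (f := fun b : α × ℕ × ℕ => (f b.1, b.2)) ((hf.comp Primrec.fst).pair Primrec.snd)

theorem comp {F : (ℕ → ℕ) → β → ℕ → ℕ} (hF : ComputableFunctional F)
    {f : α → β} (hf : Primrec f) : ComputableFunctional fun p a => F p (f a) :=
  hF.subst ComputableFunctional.id hf

/-- Computable functionals are closed under iteration, uniformly in the number of steps. -/
theorem iterate {F : (ℕ → ℕ) → ℕ → ℕ → ℕ} (hF : ComputableFunctional F) :
    ComputableFunctional fun p (n : ℕ) => (Nat.rec p (fun k q => F q k) n : ℕ → ℕ) := by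
  obtain ⟨R, hR, hm, h⟩ := id hF
  set I : (ℕ → ℕ) → ℕ → ℕ → ℕ := fun p n => (Nat.rec p (fun k q => F q k) n : ℕ → ℕ) with hI
  have hI1 : ∀ p n, I p (n + 1) = F (I p n) n := fun _ _ => rfl
  have hl : Primrec₂ fun (L : List (List ℕ)) j => L.getD j [] := Primrec.list_getD []
  -- A value of the `n`-th iterate is certified by a list of words: word 0 is an initial segment of
  -- `p`, each entry of word `j + 1` is confirmed by `R` from word `j`, and word `n` is long enough
  -- to contain the value. Only the condition on word 0 involves `p`.
  have h1 : Semidecidable fun p (c : (ℕ × ℕ × ℕ) × List (List ℕ)) =>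
      c.2.getD 0 [] = initSeg p (c.2.getD 0 []).length :=
    (ComputableFunctional.id (α := Unit)).semidecidable_initSeg.comp
      (f := fun c : (ℕ × ℕ × ℕ) × List (List ℕ) => ((), c.2.getD 0 []))
      ((Primrec.const ()).pair (hl.comp Primrec.snd (Primrec.const 0)))
  let E := ((ℕ × ℕ × ℕ) × List (List ℕ))
  have hx : Primrec fun x : (E × ℕ) × ℕ => x.1.1.2.getD (x.1.2 + 1) [] :=
    hl.comp (Primrec.snd.comp (Primrec.fst.comp Primrec.fst))
      (Primrec.succ.comp (Primrec.snd.comp Primrec.fst))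
  have h2a : PrimrecPred fun x : (E × ℕ) × ℕ => R (x.1.1.2.getD x.1.2 [],
      x.1.2, x.2, (x.1.1.2.getD (x.1.2 + 1) []).getD x.2 0) :=
    hR.comp ((hl.comp (Primrec.snd.comp (Primrec.fst.comp Primrec.fst))
      (Primrec.snd.comp Primrec.fst)).pair ((Primrec.snd.comp Primrec.fst).pair
        (Primrec.snd.pair ((Primrec.list_getD 0).comp hx Primrec.snd))))
  have h2b : PrimrecPred fun y : E × ℕ => ∀ i < (y.1.2.getD (y.2 + 1) []).length,
      R (y.1.2.getD y.2 [], y.2, i, (y.1.2.getD (y.2 + 1) []).getD i 0) :=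
    h2a.forall_lt_of (Primrec.list_length.comp (hl.comp (Primrec.snd.comp Primrec.fst)
        (Primrec.succ.comp Primrec.snd)))
  have h2 : PrimrecPred fun c : E => ∀ j < c.1.1, ∀ i < (c.2.getD (j + 1) []).length,
      R (c.2.getD j [], j, i, (c.2.getD (j + 1) []).getD i 0) :=
    h2b.forall_lt_of (Primrec.fst.comp Primrec.fst)
  have hn : Primrec fun c : E => c.2.getD c.1.1 [] :=
    hl.comp Primrec.snd (Primrec.fst.comp Primrec.fst)
  have hc : Primrec fun c : E => c.1.2.1 := Primrec.fst.comp (Primrec.snd.comp Primrec.fst)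
  have h3 : PrimrecPred fun c : E => c.1.2.1 < (c.2.getD c.1.1 []).length ∧
      (c.2.getD c.1.1 []).getD c.1.2.1 0 = c.1.2.2 :=
    (Primrec.nat_lt.comp hc (Primrec.list_length.comp hn)).and
      (Primrec.eq.comp ((Primrec.list_getD 0).comp hn hc)
        (Primrec.snd.comp (Primrec.snd.comp Primrec.fst)))
  refine (h1.and (Semidecidable.primrec (h2.and h3))).ex.of_eq ?_
  rintro p ⟨n, m, v⟩
  simp only
  have hstep : ∀ j i, ∃ k, R (initSeg (I p j) k, j, i, I p (j + 1) i) := fun j i =>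
    (h (I p j) (j, i, I p (j + 1) i)).1 rfl
  constructor
  · rintro ⟨L, hL0, hL, hmn, rfl⟩
    have key : ∀ j ≤ n, L.getD j [] = initSeg (I p j) (L.getD j []).length := by
      intro j
      induction j with
      | zero => exact fun _ => hL0
      | succ j ih =>
        intro hj
        refine eq_initSeg_iff.2 fun i hi => ?_
        have := hL j hj i hi
        rw [ih (by omega)] at this
        exact (h (I p j) (j, i, _)).2 ⟨_, this⟩
    exact eq_initSeg_iff.1 (key n le_rfl) m hmn
  · rintro rfl
    have hu : ∀ j N, ∃ k, ∀ i < N, R (initSeg (I p j) k, j, i, I p (j + 1) i) := by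
      intro j N
      choose k hk using hstep j
      exact ⟨(Finset.range N).sup k, fun i hi => hm _ _ _
        (initSeg_prefix _ (Finset.le_sup (f := k) (Finset.mem_range.2 hi))) (hk i)⟩
    choose κ hκ using hu
    -- The lengths are found backwards: `m + 1` entries of the last iterate are needed, and stage
    -- `j` must be long enough to confirm the required part of stage `j + 1`. The recursion runs on
    -- `n - j`.
    let M : ℕ → ℕ := fun j => Nat.rec (m + 1) (fun t acc => κ (n - 1 - t) acc) (n - j)
    have hMn : M n = m + 1 := by simp [M]
    have hM : ∀ j < n, M j = κ j (M (j + 1)) := by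
      intro j hj
      have e : n - j = (n - (j + 1)) + 1 := by omega
      have e' : n - 1 - (n - (j + 1)) = j := by omega
      simp only [M]
      rw [e]
      simp only [e']
    have hget : ∀ j ≤ n, ((List.range (n + 1)).map fun j => initSeg (I p j) (M j)).getD j [] =
        initSeg (I p j) (M j) := by
      intro j hj
      simp [Nat.lt_succ_of_le hj]
    refine ⟨(List.range (n + 1)).map fun j => initSeg (I p j) (M j), ?_, ?_, ?_⟩
    · rw [hget 0 (Nat.zero_le _), initSeg_length]
      rfl
    · intro j hj i hi
      rw [hget (j + 1) hj, initSeg_length] at hi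
      rw [hget (j + 1) hj, hget j hj.le, initSeg_getD hi, hM j hj]
      exact hκ j _ i hi
    · rw [hget n le_rfl, initSeg_length, hMn]
      exact ⟨m.lt_succ_self, initSeg_getD m.lt_succ_self⟩

end ComputableFunctional

end Semidecidable

/-! Pairs of sequences, and sequences as enumerations of open sets -/

section Functionals

variable {α β : Type*} [Primcodable α] [Primcodable β]

/-- The even entries of a sequence. -/
def evens (p : ℕ → ℕ) : ℕ → ℕ := fun n => p (2 * n)

/-- The odd entries of a sequence. -/
def odds (p : ℕ → ℕ) : ℕ → ℕ := fun n => p (2 * n + 1)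

/-- The sequence with even entries `p` and odd entries `q`. -/
def merge (p q : ℕ → ℕ) : ℕ → ℕ := fun n => if n % 2 = 0 then p (n / 2) else q (n / 2)

@[simp] theorem evens_merge (p q : ℕ → ℕ) : evens (merge p q) = p := by
  funext n
  simp [evens, merge]

@[simp] theorem odds_merge (p q : ℕ → ℕ) : odds (merge p q) = q := by
  funext n
  have h1 : (2 * n + 1) % 2 = 1 := by omega
  have h2 : (2 * n + 1) / 2 = n := by omega
  simp [odds, merge, h1, h2]

/-- The sequence `p` without its first entry. -/
def tail (p : ℕ → ℕ) : ℕ → ℕ := fun n => p (n + 1)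

/-- The sequence `p` with the entry `c` prepended. -/
def cons (c : ℕ) (p : ℕ → ℕ) : ℕ → ℕ := fun n => if n = 0 then c else p (n - 1)

@[simp] theorem tail_cons (c : ℕ) (p : ℕ → ℕ) : tail (cons c p) = p := by
  funext n
  simp [tail, cons]

/-- The words enumerated by `p` include an initial segment of `q`. -/
def Accepts (p q : ℕ → ℕ) : Prop := ∃ k n, p k = Encodable.encode (initSeg q n) + 1

theorem isName_openSets_iff {X : Type*} [RepresentedSpace X] {p : ℕ → ℕ} {U : OpenSets X} :
    IsName p U ↔ ∀ q x, IsName q x → (x ∈ U.carrier ↔ Accepts p q) := Iff.rfl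

namespace ComputableFunctional

theorem reindex {F : (ℕ → ℕ) → β → ℕ → ℕ} (hF : ComputableFunctional F) {f : α × ℕ → β}
    {g : α × ℕ → ℕ} (hf : Primrec f) (hg : Primrec g) :
    ComputableFunctional fun p a n => F p (f (a, n)) (g (a, n)) := by
  have h : Primrec fun b : α × ℕ × ℕ => (b.1, b.2.1) :=
    Primrec.fst.pair (Primrec.fst.comp Primrec.snd)
  exact Semidecidable.comp hF (f := fun b : α × ℕ × ℕ => (f (b.1, b.2.1), g (b.1, b.2.1), b.2.2))
    ((hf.comp h).pair ((hg.comp h).pair (Primrec.snd.comp Primrec.snd)))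

theorem ite {c : α × ℕ → Prop} [DecidablePred c] (hc : PrimrecPred c)
    {F G : (ℕ → ℕ) → α → ℕ → ℕ} (hF : ComputableFunctional F) (hG : ComputableFunctional G) :
    ComputableFunctional fun p a n => if c (a, n) then F p a n else G p a n := by
  have h : PrimrecPred fun b : α × ℕ × ℕ => c (b.1, b.2.1) :=
    hc.comp (Primrec.fst.pair (Primrec.fst.comp Primrec.snd))
  refine (((Semidecidable.primrec h).and hF).or ((Semidecidable.primrec h.not).and hG)).of_eq ?_
  intro p b
  by_cases hb : c (b.1, b.2.1) <;> simp [hb]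

protected theorem const {f : α × ℕ → ℕ} (hf : Primrec f) :
    ComputableFunctional fun (_ : ℕ → ℕ) a n => f (a, n) :=
  lookup (f := fun _ => 0) (g := fun b => f b.1) (Primrec.const 0) (hf.comp Primrec.fst)

variable {F G : (ℕ → ℕ) → α → ℕ → ℕ}

protected theorem evens (hF : ComputableFunctional F) :
    ComputableFunctional fun p a => evens (F p a) :=
  hF.reindex Primrec.fst (Primrec.nat_double.comp Primrec.snd)

protected theorem odds (hF : ComputableFunctional F) :
    ComputableFunctional fun p a => odds (F p a) :=
  hF.reindex Primrec.fst (Primrec.nat_double_succ.comp Primrec.snd)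

protected theorem merge (hF : ComputableFunctional F) (hG : ComputableFunctional G) :
    ComputableFunctional fun p a => merge (F p a) (G p a) := by
  have h : Primrec fun b : α × ℕ => b.2 / 2 :=
    Primrec.nat_div.comp Primrec.snd (Primrec.const 2)
  exact ite (c := fun b : α × ℕ => b.2 % 2 = 0)
    (Primrec.eq.comp (Primrec.nat_mod.comp Primrec.snd (Primrec.const 2)) (Primrec.const 0))
    (hF.reindex Primrec.fst h) (hG.reindex Primrec.fst h)

protected theorem tail (hF : ComputableFunctional F) :
    ComputableFunctional fun p a => tail (F p a) :=
  hF.reindex Primrec.fst (Primrec.succ.comp Primrec.snd)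

protected theorem cons (c : ℕ) (hF : ComputableFunctional F) :
    ComputableFunctional fun p a => cons c (F p a) :=
  ite (c := fun b : α × ℕ => b.2 = 0) (Primrec.eq.comp Primrec.snd (Primrec.const 0))
    (ComputableFunctional.const (Primrec.const c))
    (hF.reindex Primrec.fst (Primrec.pred.comp Primrec.snd))

end ComputableFunctional

/-! ### Acceptance, abstraction, and ordinary computability -/

namespace Semidecidable

variable {F G : (ℕ → ℕ) → α → ℕ → ℕ}

theorem entry (hF : ComputableFunctional F) {f g : α → ℕ} (hf : Primrec f) (hg : Primrec g) :
    Semidecidable fun p a => F p a (f a) = g a :=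
  Semidecidable.comp hF (Primrec.id.pair (hf.pair hg))

theorem accepts (hF : ComputableFunctional F) (hG : ComputableFunctional G) :
    Semidecidable fun p a => Accepts (F p a) (G p a) := by
  have h1 : Semidecidable fun p (c : α × ℕ × List ℕ) =>
      F p c.1 c.2.1 = Encodable.encode c.2.2 + 1 :=
    (Semidecidable.entry (F := fun p (c : α × ℕ × List ℕ) => F p c.1) (hF.comp Primrec.fst)
      (Primrec.fst.comp Primrec.snd)
      (Primrec.succ.comp (Primrec.encode.comp (Primrec.snd.comp Primrec.snd))))
  have h2 : Semidecidable fun p (c : α × ℕ × List ℕ) => c.2.2 = initSeg (G p c.1) c.2.2.length :=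
    hG.semidecidable_initSeg.comp (Primrec.fst.pair (Primrec.snd.comp Primrec.snd))
  refine (h1.and h2).ex.of_eq fun p a => ?_
  constructor
  · rintro ⟨⟨k, w⟩, hk, hw⟩
    exact ⟨k, w.length, by simpa only [← hw] using hk⟩
  · rintro ⟨k, n, hk⟩
    exact ⟨(k, initSeg (G p a) n), hk, by simp only [initSeg_length]⟩

/-- Abstraction: a semidecidable relation between `p` and `q` can be turned, computably in `p`,
into an enumeration that accepts the related `q`. -/
theorem exists_accepts {P : (ℕ → ℕ) → α → Prop} (hP : Semidecidable P) :
    ∃ T : (ℕ → ℕ) → α → ℕ → ℕ, ComputableFunctional T ∧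
      ∀ p a q, Accepts (T p a) q ↔ P (merge p q) a := by
  classical
  obtain ⟨R, hR, hm, h⟩ := hP
  -- Interleaves two words of equal length, which turns initial segments of `p` and `q` into one of
  -- `merge p q`.
  let E : List ℕ × List ℕ → List ℕ := fun x =>
    (List.range (2 * x.2.length)).map (merge (fun i => x.1.getD i 0) fun i => x.2.getD i 0)
  have hE : Primrec E := by
    have hd : Primrec fun y : (List ℕ × List ℕ) × ℕ => y.2 / 2 :=
      Primrec.nat_div.comp Primrec.snd (Primrec.const 2)
    refine Primrec.list_map (Primrec.list_range.comp
      (Primrec.nat_double.comp (Primrec.list_length.comp Primrec.snd))) ?_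
    exact Primrec.ite (Primrec.eq.comp (Primrec.nat_mod.comp Primrec.snd (Primrec.const 2))
      (Primrec.const 0)) ((Primrec.list_getD 0).comp (Primrec.fst.comp Primrec.fst) hd)
      ((Primrec.list_getD 0).comp (Primrec.snd.comp Primrec.fst) hd)
  have hE' : ∀ p q n, E (initSeg p n, initSeg q n) = initSeg (merge p q) (2 * n) := by
    intro p q n
    simp only [E, initSeg_length]
    refine List.map_congr_left fun i hi => ?_
    have : i / 2 < n := by
      have := List.mem_range.1 hi
      omega
    simp only [merge, initSeg_getD this]
  let W : ℕ → List ℕ := fun n => (Encodable.decode (α := List ℕ) n).getD []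
  have hW : Primrec W := Primrec.option_getD.comp Primrec.decode (Primrec.const [])
  have hWe : ∀ v, W (Encodable.encode v) = v := fun v => by simp [W]
  -- Position `n` lists the word coded by `n` if that word, interleaved with equally many entries of
  -- `p`, already confirms the relation; the entry 0 lists nothing.
  let T : (ℕ → ℕ) → α → ℕ → ℕ := fun p a n =>
    if R (E (initSeg p (W n).length, W n), a) then Encodable.encode (W n) + 1 else 0
  refine ⟨T, ?_, fun p a q => ?_⟩
  · let C := (α × ℕ × ℕ) × List ℕ
    have hw : Primrec fun c : C => W c.1.2.1 :=
      hW.comp (Primrec.fst.comp (Primrec.snd.comp Primrec.fst))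
    have h1 : Semidecidable fun p (c : C) => c.2 = initSeg p c.2.length :=
      ComputableFunctional.id.semidecidable_initSeg.comp (Primrec.fst.pair Primrec.snd)
    have h2 : PrimrecPred fun c : C => c.2.length = (W c.1.2.1).length :=
      Primrec.eq.comp (Primrec.list_length.comp Primrec.snd) (Primrec.list_length.comp hw)
    have h3 : PrimrecPred fun c : C =>
        (if R (E (c.2, W c.1.2.1), c.1.1) then Encodable.encode (W c.1.2.1) + 1 else 0) =
          c.1.2.2 :=
      Primrec.eq.comp (Primrec.ite (hR.comp ((hE.comp (Primrec.snd.pair hw)).pair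
        (Primrec.fst.comp Primrec.fst))) (Primrec.succ.comp (Primrec.encode.comp hw))
        (Primrec.const 0)) (Primrec.snd.comp (Primrec.snd.comp Primrec.fst))
    refine (h1.and (Semidecidable.primrec (h2.and h3))).ex.of_eq ?_
    rintro p ⟨a, n, v⟩
    simp only [T]
    constructor
    · rintro ⟨w, hw, hl, hv⟩
      rwa [← hl, ← hw]
    · intro hv
      exact ⟨initSeg p (W n).length, by rw [initSeg_length], initSeg_length _ _, hv⟩
  · rw [h]
    constructor
    · rintro ⟨k, n, hk⟩
      simp only [T] at hk
      split_ifs at hk with hr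
      have hkn : W k = initSeg q n := Encodable.encode_injective (Nat.succ_injective hk)
      rw [hkn, initSeg_length, hE'] at hr
      exact ⟨_, hr⟩
    · rintro ⟨k, hk⟩
      refine ⟨Encodable.encode (initSeg q k), k, ?_⟩
      simp only [T, hWe, initSeg_length, hE']
      rw [if_pos (hm _ _ _ (initSeg_prefix _ (by omega)) hk)]

/-- Evaluation with a step bound is primitive recursive, and an existential quantifier over the
bound remains. -/
theorem of_computable {f : α → β} (hf : Computable f) :
    Semidecidable fun (_ : ℕ → ℕ) (b : α × β) => f b.1 = b.2 := by
  obtain ⟨c, hc⟩ := Nat.Partrec.Code.exists_code.1 hf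
  have h : PrimrecPred fun d : (α × β) × ℕ =>
      Nat.Partrec.Code.evaln d.2 c (Encodable.encode d.1.1) = some (Encodable.encode d.1.2) :=
    Primrec.eq.comp (Nat.Partrec.Code.primrec_evaln.comp
      ((Primrec.snd.pair (Primrec.const c)).pair
        (Primrec.encode.comp (Primrec.fst.comp Primrec.fst))))
      (Primrec.option_some.comp (Primrec.encode.comp (Primrec.snd.comp Primrec.fst)))
  refine (Semidecidable.primrec h).ex.of_eq fun p b => ?_
  have h1 : Encodable.encode b.2 ∈ Nat.Partrec.Code.eval c (Encodable.encode b.1) ↔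
      f b.1 = b.2 := by
    rw [hc]
    simp [eq_comm]
  rw [← h1, Nat.Partrec.Code.evaln_complete]
  rfl

end Semidecidable

theorem ComputableFunctional.of_computable {p : ℕ → ℕ} (hp : Computable p) :
    ComputableFunctional fun (_ : ℕ → ℕ) (_ : α) => p :=
  (Semidecidable.of_computable hp).comp Primrec.snd

/-- One direction searches for an initial segment on which the algorithm answers; the other searches
for a confirmed value, which is unique on `D`. Agreement is demanded only on `D`, so partial
realizers can be handled through a relation. -/
theorem typeTwoComputableOn_iff {F : (ℕ → ℕ) → ℕ → ℕ} {D : Set (ℕ → ℕ)} :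
    TypeTwoComputableOn F D ↔ ∃ G : (ℕ → ℕ) → ℕ × ℕ → Prop, Semidecidable G ∧
      ∀ p ∈ D, ∀ n v, G p (n, v) ↔ F p n = v := by
  classical
  constructor
  · rintro ⟨φ, hφ, h⟩
    refine ⟨fun p b => ∃ w : List ℕ, w = initSeg p w.length ∧ φ w b.1 = some b.2, ?_, ?_⟩
    · have h1 : Semidecidable fun p (c : (ℕ × ℕ) × List ℕ) => c.2 = initSeg p c.2.length :=
        ComputableFunctional.id.semidecidable_initSeg.comp (Primrec.fst.pair Primrec.snd)
      have h2 : Semidecidable fun (_ : ℕ → ℕ) (c : (ℕ × ℕ) × List ℕ) =>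
          φ c.2 c.1.1 = some c.1.2 :=
        (Semidecidable.of_computable hφ).comp (f := fun c : (ℕ × ℕ) × List ℕ =>
          ((c.2, c.1.1), some c.1.2)) ((Primrec.snd.pair (Primrec.fst.comp Primrec.fst)).pair
            (Primrec.option_some.comp (Primrec.snd.comp Primrec.fst)))
      exact (h1.and h2).ex
    · intro p hp n v
      constructor
      · rintro ⟨w, hw, hv⟩
        rw [hw] at hv
        exact ((h p hp n).2 _ _ hv).symm
      · rintro rfl
        obtain ⟨k, hk⟩ := (h p hp n).1
        exact ⟨_, by rw [initSeg_length], hk⟩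
  · rintro ⟨G, ⟨R, hR, hm, hG⟩, h⟩
    -- The search is bounded by the length of the word. `Nat.findGreatest` returns 0 also when it
    -- finds nothing, so the algorithm below tests the result again.
    let g : List ℕ × ℕ → ℕ := fun x => x.1.length.findGreatest fun v => R (x.1, x.2, v)
    have hR' : PrimrecRel fun (x : List ℕ × ℕ) v => R (x.1, x.2, v) :=
      hR.comp ((Primrec.fst.comp Primrec.fst).pair
        ((Primrec.snd.comp Primrec.fst).pair Primrec.snd))
    have hg : Primrec g :=
      Primrec.nat_findGreatest (Primrec.list_length.comp Primrec.fst) hR'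
    refine ⟨fun w n => if R (w, n, g (w, n)) then some (g (w, n)) else none,
      (Primrec.ite (hR'.comp Primrec.id hg) (Primrec.option_some.comp hg)
        (Primrec.const none)).to_comp, fun p hp n => ?_⟩
    have hsound : ∀ k v, R (initSeg p k, n, v) → v = F p n := fun k v hv =>
      ((h p hp n v).1 ((hG p (n, v)).2 ⟨k, hv⟩)).symm
    constructor
    · obtain ⟨k, hk⟩ := (hG p (n, F p n)).1 ((h p hp n _).2 rfl)
      -- Long enough both to confirm the value and to bring it within the search bound.
      refine ⟨max k (F p n), ?_⟩
      have hk' := hm _ _ _ (initSeg_prefix p (le_max_left k (F p n))) hk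
      have hr : R (initSeg p (max k (F p n)), n, g (initSeg p (max k (F p n)), n)) :=
        Nat.findGreatest_spec (P := fun v => R (initSeg p (max k (F p n)), n, v))
          (m := F p n) (by simp [initSeg_length]) hk'
      simp only [hsound _ _ hr]
      rw [if_pos hk']
    · intro k v hv
      simp only at hv
      split_ifs at hv with hr
      rw [← Option.some.inj hv]
      exact hsound _ _ hr

end Functionals

/-! Presubbases and prebases in terms of semidecidable relations between names -/

/-- A parameter-free semidecidable property of sequences. -/
def SemidecidablePred (P : (ℕ → ℕ) → Prop) : Prop := Semidecidable fun p (_ : Unit) => P p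

theorem SemidecidablePred.subst {α : Type*} [Primcodable α] {P : (ℕ → ℕ) → Prop}
    (hP : SemidecidablePred P) {F : (ℕ → ℕ) → α → ℕ → ℕ} (hF : ComputableFunctional F) :
    Semidecidable fun p a => P (F p a) :=
  Semidecidable.subst hP hF (Primrec.const ())

theorem SemidecidablePred.exists_accepts {P : (ℕ → ℕ) → Prop} (hP : SemidecidablePred P) :
    ∃ T : (ℕ → ℕ) → ℕ → ℕ, ComputableFunctional (fun p (_ : Unit) => T p) ∧
      ∀ p q, Accepts (T p) q ↔ P (merge p q) := by
  obtain ⟨T, hT, h⟩ := Semidecidable.exists_accepts hP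
  exact ⟨fun p => T p (), hT, fun p q => h p () q⟩

theorem ComputableFunctional.typeTwoComputableOn {T : (ℕ → ℕ) → ℕ → ℕ}
    (hT : ComputableFunctional fun p (_ : Unit) => T p) (D : Set (ℕ → ℕ)) :
    TypeTwoComputableOn T D :=
  typeTwoComputableOn_iff.2 ⟨fun p b => T p b.1 = b.2,
    Semidecidable.comp hT ((Primrec.const ()).pair Primrec.id), fun _ _ _ _ => Iff.rfl⟩

/-- Uncurrying, the converse of abstraction: it suffices to find an entry of `F p` and a word listed
there that is an initial segment of `q`. -/
theorem _root_.TypeTwoComputableOn.exists_semidecidablePred {F : (ℕ → ℕ) → ℕ → ℕ}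
    {D : Set (ℕ → ℕ)} (hF : TypeTwoComputableOn F D) :
    ∃ P, SemidecidablePred P ∧ ∀ p ∈ D, ∀ q, P (merge p q) ↔ Accepts (F p) q := by
  obtain ⟨G, hG, h⟩ := typeTwoComputableOn_iff.1 hF
  refine ⟨fun c => ∃ b : ℕ × List ℕ, G (evens c) (b.1, Encodable.encode b.2 + 1) ∧
    b.2 = initSeg (odds c) b.2.length, ?_, fun p hp q => ?_⟩
  · have h1 : Semidecidable fun p (c : Unit × ℕ × List ℕ) =>
        G (evens p) (c.2.1, Encodable.encode c.2.2 + 1) :=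
      hG.subst ComputableFunctional.id.evens
        (f := fun c : Unit × ℕ × List ℕ => (c.2.1, Encodable.encode c.2.2 + 1))
        ((Primrec.fst.comp Primrec.snd).pair
          (Primrec.succ.comp (Primrec.encode.comp (Primrec.snd.comp Primrec.snd))))
    have h2 : Semidecidable fun p (c : Unit × ℕ × List ℕ) =>
        c.2.2 = initSeg (odds p) c.2.2.length :=
      ComputableFunctional.id.odds.semidecidable_initSeg.comp
        (f := fun c : Unit × ℕ × List ℕ => (c.1, c.2.2))
        (Primrec.fst.pair (Primrec.snd.comp Primrec.snd))
    exact (h1.and h2).ex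
  · simp only [evens_merge, odds_merge, h p hp]
    constructor
    · rintro ⟨⟨k, w⟩, hk, hw⟩
      exact ⟨k, w.length, by simpa only [← hw] using hk⟩
    · rintro ⟨k, n, hk⟩
      exact ⟨(k, initSeg q n), hk, by simp only [initSeg_length]⟩

section Bases

variable {X : Type u} {R : Type v} {S : Type w} [RepresentedSpace X] [RepresentedSpace R]
  [RepresentedSpace S]

/-- `u` is a name of the set `U` as an open set. -/
def NamesOpen (u : ℕ → ℕ) (U : Set X) : Prop := ∀ q x, IsName q x → (x ∈ U ↔ Accepts u q)

theorem NamesOpen.isOpen {U : Set X} {u : ℕ → ℕ} (h : NamesOpen u U) :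
    IsOpen[finalTopology X] U := by
  rw [finalTopology_isOpen_iff]
  intro p x hp hx
  obtain ⟨k, n, hk⟩ := (h p x hp).1 hx
  exact ⟨n, fun q y hq hy => (h q y hy).2 ⟨k, n, by rw [hk, initSeg_eq_iff.2 hq]⟩⟩

theorem exists_namesOpen {U : Set X} (h : IsOpen[finalTopology X] U) : ∃ u, NamesOpen u U :=
  exists_name (⟨U, h⟩ : OpenSets X)

/-- The first condition is the uncurried transpose and the second its partial inverse. Together they
already give openness of the sets `{r | x ∈ B r}` and injectivity, so constructions need to verify
nothing else. -/
theorem isComputablePresubbase_iff {B : R → OpenSets X} :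
    IsComputablePresubbase B ↔
      (∃ P, SemidecidablePred P ∧ ∀ p x q r, IsName p x → IsName q r →
        (x ∈ (B r).carrier ↔ P (merge p q))) ∧
      ∃ G : (ℕ → ℕ) → ℕ × ℕ → Prop, Semidecidable G ∧
        ∀ u x, NamesOpen u {r | x ∈ (B r).carrier} →
          ∃ p, IsName p x ∧ ∀ n v, G u (n, v) ↔ p n = v := by
  classical
  constructor
  · rintro ⟨ho, hinj, ⟨F, hF, hF'⟩, F', hG, hG'⟩
    obtain ⟨P, hP, hPF⟩ := hF.exists_semidecidablePred
    obtain ⟨G, hGs, hGF⟩ := typeTwoComputableOn_iff.1 hG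
    refine ⟨⟨P, hP, fun p x q r hp hq => ?_⟩, G, hGs, fun u x hu => ?_⟩
    · obtain ⟨_, rfl, hy⟩ := hF' p x hp (singleton_nonempty _)
      rw [hPF p ⟨x, hp, singleton_nonempty _⟩]
      exact isName_openSets_iff.1 hy q r hq
    · have hne : {x' : X | (⟨{r | x' ∈ (B r).carrier}, ho x'⟩ : OpenSets R) =
          ⟨{r | x ∈ (B r).carrier}, ho x⟩}.Nonempty := ⟨x, rfl⟩
      obtain ⟨y, hy, hyn⟩ := hG' u ⟨{r | x ∈ (B r).carrier}, ho x⟩ hu hne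
      obtain rfl := hinj hy
      exact ⟨_, hyn, hGF u ⟨_, hu, hne⟩⟩
  · rintro ⟨⟨P, hP, hPB⟩, G, hG, hGB⟩
    obtain ⟨T, hT, hTP⟩ := hP.exists_accepts
    have hTB : ∀ p x, IsName p x → NamesOpen (T p) {r | x ∈ (B r).carrier} :=
      fun p x hp q r hq => by
        rw [hTP, ← hPB p x q r hp hq]
        rfl
    refine ⟨fun x => ?_, fun x y hxy => ?_, ⟨T, hT.typeTwoComputableOn _, ?_⟩, ?_⟩
    · obtain ⟨p, hp⟩ := exists_name x
      exact (hTB p x hp).isOpen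
    · obtain ⟨p, hp⟩ := exists_name x
      -- Injectivity: if `x` and `y` have the same transpose, then `T p` names it for both, and `G`
      -- reads off a single sequence that names both points.
      obtain ⟨q, hq, hqG⟩ := hGB (T p) x (hTB p x hp)
      have hset := congrArg OpenSets.carrier hxy
      obtain ⟨q', hq', hqG'⟩ := hGB (T p) y fun s r hs =>
        (Set.ext_iff.1 hset r).symm.trans (hTB p x hp s r hs)
      obtain rfl : q = q' := funext fun n => (hqG n _).1 ((hqG' n _).2 rfl)
      exact unique hq hq'
    · exact fun p x hp _ => ⟨_, rfl, hTB p x hp⟩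
    · let F : (ℕ → ℕ) → ℕ → ℕ := fun u n =>
        if h : ∃ v, G u (n, v) then Classical.choose h else 0
      have hF : ∀ u p, (∀ n v, G u (n, v) ↔ p n = v) → F u = p := by
        intro u p h
        funext n
        have he : ∃ v, G u (n, v) := ⟨p n, (h n _).2 rfl⟩
        simp only [F, dif_pos he]
        exact ((h n _).1 (Classical.choose_spec he)).symm
      refine ⟨F, typeTwoComputableOn_iff.2 ⟨G, hG, ?_⟩, ?_⟩
      · rintro u ⟨U, hu, x, rfl⟩ n v
        obtain ⟨p, -, hp⟩ := hGB u x hu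
        rw [hF u p hp, hp]
      · rintro u U hu ⟨x, rfl⟩
        obtain ⟨p, hpx, hp⟩ := hGB u x hu
        exact ⟨x, rfl, by rwa [hF u p hp]⟩

/-- `k` accepts precisely the names of the open supersets of `K`. -/
def NamesSupersets (k : ℕ → ℕ) (K : Set R) : Prop :=
  ∀ u (U : Set R), NamesOpen u U → (K ⊆ U ↔ Accepts k u)

/-- A finite union of open sets that contains `K` also contains its saturation. -/
theorem isCompact_saturation {K : Set R} (hK : @IsCompact R (finalTopology R) K) :
    @IsCompact R (finalTopology R) {r | ∀ U : OpenSets R, K ⊆ U.carrier → r ∈ U.carrier} := by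
  let _ := finalTopology R
  refine isCompact_of_finite_subcover fun {ι} U hU hcov => ?_
  obtain ⟨t, ht⟩ := hK.elim_finite_subcover U hU
    fun r hr => hcov fun V hV => hV hr
  exact ⟨t, fun r hr => hr ⟨_, isOpen_biUnion fun i _ => hU i⟩ ht⟩

/-- The sets `{r | x ∈ B r}` are open, so containing `K` is the same as containing its saturation,
and meeting `A` the same as meeting its closure. Hence images of compact sets and products of overt
sets can be used without saturating or closing them. -/
theorem isComputablePrebase_iff {B : R → OpenSets X} :
    IsComputablePrebase B ↔ IsComputablePresubbase B ∧
      (∃ Q, SemidecidablePred Q ∧ ∀ (K : Set R) k, @IsCompact R (finalTopology R) K →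
        NamesSupersets k K → ∃ A : Set R,
          (∀ u U, NamesOpen u U → ((A ∩ U).Nonempty ↔ Q (merge k u))) ∧
          ∀ x, (∀ r ∈ K, x ∈ (B r).carrier) ↔ ∃ r ∈ A, x ∈ (B r).carrier) ∧
      ∀ x, ∃ r, x ∈ (B r).carrier := by
  have hcov : Covers B ↔ ∀ x, ∃ r, x ∈ (B r).carrier := by
    simp [Covers, eq_univ_iff_forall]
  have hUnion : ∀ K A : Set R, ⋂ r ∈ K, (B r).carrier = ⋃ r ∈ A, (B r).carrier ↔
      ∀ x, (∀ r ∈ K, x ∈ (B r).carrier) ↔ ∃ r ∈ A, x ∈ (B r).carrier := fun K A => by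
    simp [Set.ext_iff]
  simp only [IsComputablePrebase, hcov, hUnion]
  refine and_congr_right fun hB => and_congr_left fun _ => ?_
  constructor
  · rintro ⟨Q, hQ, ⟨F, hF, hFQ⟩, hQB⟩
    obtain ⟨P, hP, hPF⟩ := hF.exists_semidecidablePred
    refine ⟨P, hP, fun K k hK hk => ?_⟩
    let K' : CompactSets R := ⟨_, isCompact_saturation hK, fun r hr U hU =>
      hr U fun s hs => hs U hU⟩
    have hKK : ∀ U : OpenSets R, K'.carrier ⊆ U.carrier ↔ K ⊆ U.carrier := fun U =>
      ⟨fun h r hr => h fun V hV => hV hr, fun h r hr => hr U h⟩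
    have hk' : IsName k K' := fun u U hu => (hKK U).trans (hk u U.carrier hu)
    obtain ⟨A, hA, hAk⟩ := hFQ k K' hk' (hQ K')
    refine ⟨A.carrier, fun u U hu => ?_, fun x => ?_⟩
    · rw [hPF k ⟨K', hk', hQ K'⟩]
      exact isName_openSets_iff.1 hAk u ⟨U, hu.isOpen⟩ hu
    · rw [← hQB K' A hA x]
      obtain ⟨ho, -⟩ := hB
      exact ((hKK ⟨{r | x ∈ (B r).carrier}, ho x⟩).symm : (K ⊆ _ ↔ _))
  · rintro ⟨Q, hQ, hQB⟩
    obtain ⟨T, hT, hTQ⟩ := hQ.exists_accepts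
    have key : ∀ (K : CompactSets R) k, IsName k K → ∃ A : ClosedSets R, IsName (T k) A ∧
        ∀ x, (∀ r ∈ K.carrier, x ∈ (B r).carrier) ↔ ∃ r ∈ A.carrier, x ∈ (B r).carrier := by
      intro K k hk
      obtain ⟨A, hA, hBA⟩ := hQB K.carrier k K.isCompact fun u U hu => hk u ⟨U, hu.isOpen⟩ hu
      let _ := finalTopology R
      have hcl : ∀ V : Set R, IsOpen V → ((closure A ∩ V).Nonempty ↔ (A ∩ V).Nonempty) :=
        fun V hV => closure_inter_open_nonempty_iff hV
      exact ⟨⟨closure A, isClosed_closure⟩, fun u U hu =>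
        (hcl U.carrier U.isOpen).trans ((hA u U.carrier hu).trans (hTQ k u).symm),
        fun x => (hBA x).trans (hcl {r | x ∈ (B r).carrier} (hB.1 x)).symm⟩
    -- As the multivalued map, take all closed sets that satisfy the required equation; the realizer
    -- then only has to hit one of them.
    refine ⟨fun K => {A | ∀ x, (∀ r ∈ K.carrier, x ∈ (B r).carrier) ↔
      ∃ r ∈ A.carrier, x ∈ (B r).carrier},
      fun K => ?_, ⟨T, hT.typeTwoComputableOn _, fun k K hk _ => ?_⟩, fun K A hA => hA⟩
    · obtain ⟨k, hk⟩ := exists_name K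
      obtain ⟨A, -, hA⟩ := key K k hk
      exact ⟨A, hA⟩
    · obtain ⟨A, hA, hBA⟩ := key K k hk
      exact ⟨A, hBA, hA⟩

/-! ### Overt index spaces and images of compact sets -/

theorem IsOvert.exists_semidecidablePred (hR : IsOvert R) :
    ∃ E, SemidecidablePred E ∧ ∀ u (U : Set R), NamesOpen u U → (E u ↔ U.Nonempty) := by
  obtain ⟨a, ha, hn⟩ := hR
  refine ⟨fun u => Accepts a u, Semidecidable.accepts (ComputableFunctional.of_computable ha)
    ComputableFunctional.id, fun u U hu => ?_⟩
  refine Iff.trans (isName_openSets_iff.1 hn u ⟨U, hu.isOpen⟩ hu).symm ?_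
  change (univ ∩ U).Nonempty ↔ _
  rw [univ_inter]

/-- Here `ρ` is a partial function, continuous with closed domain: `ho` for the empty set says that
the points without a value form an open set. Partiality is needed for the components of a coproduct
and the letters of words. -/
theorem isCompact_image_rel {K : Set R} (hK : @IsCompact R (finalTopology R) K) {ρ : R → S → Prop}
    (hρ : ∀ r s s', ρ r s → ρ r s' → s = s')
    (ho : ∀ U, IsOpen[finalTopology S] U → IsOpen[finalTopology R] {r | ∀ s, ρ r s → s ∈ U}) :
    @IsCompact S (finalTopology S) {s | ∃ r ∈ K, ρ r s} := by
  let _ := finalTopology R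
  let _ := finalTopology S
  refine isCompact_of_finite_subcover fun {ι} U hU hcov => ?_
  -- These sets form a directed open cover of `K`; a point outside the domain of `ρ` lies already in
  -- the one for the empty family.
  let V : Finset ι → Set R := fun t => {r | ∀ s, ρ r s → s ∈ ⋃ i ∈ t, U i}
  have hV : Monotone V := fun t t' htt r hr s hs =>
    biUnion_subset_biUnion_left (s := (t : Set ι)) (by exact_mod_cast htt) (hr s hs)
  have hKV : K ⊆ ⋃ t, V t := by
    intro r hr
    by_cases h : ∃ s, ρ r s
    · obtain ⟨s, hs⟩ := h
      obtain ⟨i, hi⟩ := mem_iUnion.1 (hcov ⟨r, hr, hs⟩)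
      refine mem_iUnion.2 ⟨{i}, fun s' hs' => ?_⟩
      obtain rfl := hρ r s s' hs hs'
      simpa using hi
    · exact mem_iUnion.2 ⟨∅, fun s hs => (h ⟨s, hs⟩).elim⟩
  obtain ⟨t, ht⟩ := hK.elim_directed_cover V
    (fun t => ho _ (isOpen_biUnion fun i _ => hU i)) hKV hV.directed_le
  exact ⟨t, fun s ⟨r, hr, hs⟩ => ht hr s hs⟩

/-- The image of `K` lies in `U` iff `K` lies in `{r | ∀ s, ρ a r s → s ∈ U}`, and a name of the
latter is computed from one of `U`. -/
theorem exists_namesSupersets_image_rel {α : Type*} [Primcodable α] {ρ : α → R → S → Prop}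
    (hρ : ∀ a r s s', ρ a r s → ρ a r s' → s = s') {P : (ℕ → ℕ) → α → Prop}
    (hP : Semidecidable P) (hPρ : ∀ u U q r a, NamesOpen u U → IsName q r →
      (P (merge u q) a ↔ ∀ s, ρ a r s → s ∈ U)) :
    ∃ T : (ℕ → ℕ) → α → ℕ → ℕ, ComputableFunctional T ∧ ∀ (K : Set R) k a,
      @IsCompact R (finalTopology R) K → NamesSupersets k K →
        @IsCompact S (finalTopology S) {s | ∃ r ∈ K, ρ a r s} ∧
        NamesSupersets (T k a) {s | ∃ r ∈ K, ρ a r s} := by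
  obtain ⟨W, hW, hWP⟩ := hP.exists_accepts
  obtain ⟨T, hT, hTW⟩ := (Semidecidable.accepts ComputableFunctional.id.evens
    (hW.subst ComputableFunctional.id.odds Primrec.id)).exists_accepts
  have hacc : ∀ u (U : Set S) a, NamesOpen u U →
      NamesOpen (W u a) {r | ∀ s, ρ a r s → s ∈ U} := fun u U a hu q r hq => by
    rw [hWP, hPρ u U q r a hu hq]
    rfl
  refine ⟨T, hT, fun K k a hK hk => ⟨isCompact_image_rel hK (hρ a) fun U hU => ?_,
    fun u U hu => ?_⟩⟩
  · obtain ⟨u, hu⟩ := exists_namesOpen hU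
    exact (hacc u U a hu).isOpen
  · rw [hTW, evens_merge, odds_merge]
    refine Iff.trans ?_ (hk _ _ (hacc u U a hu))
    exact ⟨fun h r hr s hs => h ⟨r, hr, hs⟩, fun h s ⟨r, hr, hs⟩ => h hr s hs⟩

end Bases

/-! Subspaces, products and meets -/

section Products

variable {X Y Z R S : Type*} [RepresentedSpace X] [RepresentedSpace Y] [RepresentedSpace Z]

theorem Covers.exists_mem {B : R → OpenSets X} (hB : Covers B) (x : X) :
    ∃ r, x ∈ (B r).carrier := by
  simpa using eq_univ_iff_forall.1 hB x

theorem mem_prodFamily {BX : R → OpenSets X} {BY : S → OpenSets Y} {t : R × S} {z : X × Y} :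
    z ∈ (prodFamily BX BY t).carrier ↔ z.1 ∈ (BX t.1).carrier ∧ z.2 ∈ (BY t.2).carrier := Iff.rfl

variable [RepresentedSpace R] [RepresentedSpace S]

/-- Serves both subspaces and meets. As names of `z` and `e z` coincide, the same semidecidable
relations work unchanged. -/
theorem IsComputablePresubbase.pullback {B : R → OpenSets X} (hB : IsComputablePresubbase B)
    {B' : R → OpenSets Z} {e : Z → X} (he : ∀ p z, IsName p z ↔ IsName p (e z))
    (hB' : ∀ r z, z ∈ (B' r).carrier ↔ e z ∈ (B r).carrier) : IsComputablePresubbase B' := by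
  obtain ⟨⟨P, hP, hPB⟩, G, hG, hGB⟩ := isComputablePresubbase_iff.1 hB
  refine isComputablePresubbase_iff.2 ⟨⟨P, hP, fun p z q r hp hq => ?_⟩, G, hG, fun u z hu => ?_⟩
  · rw [hB', hPB p (e z) q r ((he p z).1 hp) hq]
  · obtain ⟨p, hp, h⟩ := hGB u (e z) fun q r hq => (hB' r z).symm.trans (hu q r hq)
    exact ⟨p, (he p z).2 hp, h⟩

theorem IsComputablePrebase.pullback {B : R → OpenSets X} (hB : IsComputablePrebase B)
    {B' : R → OpenSets Z} {e : Z → X} (he : ∀ p z, IsName p z ↔ IsName p (e z))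
    (hB' : ∀ r z, z ∈ (B' r).carrier ↔ e z ∈ (B r).carrier) : IsComputablePrebase B' := by
  obtain ⟨hB, ⟨Q, hQ, h⟩, hc⟩ := isComputablePrebase_iff.1 hB
  refine isComputablePrebase_iff.2 ⟨hB.pullback he hB', ⟨Q, hQ, fun K k hK hk => ?_⟩, fun z => ?_⟩
  · obtain ⟨A, hA, hBA⟩ := h K k hK hk
    exact ⟨A, hA, fun z => by simpa only [hB'] using hBA (e z)⟩
  · simpa only [hB'] using hc (e z)

/-- From a name of an open set in a product, a name of its section at a point can be computed. -/
theorem exists_section : ∃ W : (ℕ → ℕ) → ℕ → ℕ, ComputableFunctional (fun c (_ : Unit) => W c) ∧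
    ∀ w q q', Accepts (W (merge w q)) q' ↔ Accepts w (merge q q') := by
  have hE := (ComputableFunctional.id (α := Unit)).evens
  have h : SemidecidablePred fun d => Accepts (evens (evens d)) (merge (odds (evens d)) (odds d)) :=
    Semidecidable.accepts hE.evens (hE.odds.merge ComputableFunctional.id.odds)
  obtain ⟨W, hW, h'⟩ := h.exists_accepts
  exact ⟨W, hW, fun w q q' => by simp [h']⟩

theorem exists_section_right :
    ∃ W : (ℕ → ℕ) → ℕ → ℕ, ComputableFunctional (fun c (_ : Unit) => W c) ∧
    ∀ w q q', Accepts (W (merge w q)) q' ↔ Accepts w (merge q' q) := by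
  have hE := (ComputableFunctional.id (α := Unit)).evens
  have h : SemidecidablePred fun d => Accepts (evens (evens d)) (merge (odds d) (odds (evens d))) :=
    Semidecidable.accepts hE.evens (ComputableFunctional.id.odds.merge hE.odds)
  obtain ⟨W, hW, h'⟩ := h.exists_accepts
  exact ⟨W, hW, fun w q q' => by simp [h']⟩

theorem isName_prod_iff {p : ℕ → ℕ} {z : X × Y} :
    IsName p z ↔ IsName (evens p) z.1 ∧ IsName (odds p) z.2 := Iff.rfl

theorem isName_merge_iff {p q : ℕ → ℕ} {z : X × Y} :
    IsName (merge p q) z ↔ IsName p z.1 ∧ IsName q z.2 := by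
  rw [isName_prod_iff, evens_merge, odds_merge]

theorem isComputablePresubbase_prodFamily {BX : R → OpenSets X} {BY : S → OpenSets Y}
    (hR : IsOvert R) (hS : IsOvert S) (hX : IsComputablePresubbase BX)
    (hcX : ∀ x, ∃ r, x ∈ (BX r).carrier) (hY : IsComputablePresubbase BY)
    (hcY : ∀ y, ∃ s, y ∈ (BY s).carrier) : IsComputablePresubbase (prodFamily BX BY) := by
  obtain ⟨⟨PX, hPX, hPBX⟩, GX, hGX, hGBX⟩ := isComputablePresubbase_iff.1 hX
  obtain ⟨⟨PY, hPY, hPBY⟩, GY, hGY, hGBY⟩ := isComputablePresubbase_iff.1 hY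
  obtain ⟨ER, hER, hRE⟩ := hR.exists_semidecidablePred
  obtain ⟨ES, hES, hSE⟩ := hS.exists_semidecidablePred
  obtain ⟨W, hW, hWa⟩ := exists_section
  obtain ⟨W', hW', hWa'⟩ := exists_section_right
  obtain ⟨T, hT, hTa⟩ := SemidecidablePred.exists_accepts (hES.subst (α := Unit) (F := fun c _ => W c) hW)
  obtain ⟨T', hT', hTa'⟩ := SemidecidablePred.exists_accepts (hER.subst (α := Unit) (F := fun c _ => W' c) hW')
  have hE := (ComputableFunctional.id (α := Unit)).evens
  have hO := (ComputableFunctional.id (α := Unit)).odds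
  refine isComputablePresubbase_iff.2
    ⟨⟨fun c => PX (merge (evens (evens c)) (evens (odds c))) ∧
      PY (merge (odds (evens c)) (odds (odds c))), ?_, ?_⟩,
    fun u b => (b.1 % 2 = 0 ∧ GX (T u) (b.1 / 2, b.2)) ∨ (¬ b.1 % 2 = 0 ∧ GY (T' u) (b.1 / 2, b.2)),
    ?_, ?_⟩
  · exact (hPX.subst (hE.evens.merge hO.evens)).and (hPY.subst (hE.odds.merge hO.odds))
  · rintro p z q t ⟨hp, hp'⟩ ⟨hq, hq'⟩
    rw [mem_prodFamily, hPBX _ _ _ _ hp hq, hPBY _ _ _ _ hp' hq']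
    simp only [evens_merge, odds_merge]
    rfl
  · have h0 : PrimrecPred fun b : ℕ × ℕ => b.1 % 2 = 0 :=
      Primrec.eq.comp (Primrec.nat_mod.comp Primrec.fst (Primrec.const 2)) (Primrec.const 0)
    have hd : Primrec fun b : ℕ × ℕ => (b.1 / 2, b.2) :=
      (Primrec.nat_div.comp Primrec.fst (Primrec.const 2)).pair Primrec.snd
    exact ((Semidecidable.primrec h0).and (hGX.subst (hT.comp (Primrec.const ())) hd)).or
      ((Semidecidable.primrec h0.not).and (hGY.subst (hT'.comp (Primrec.const ())) hd))
  · rintro u ⟨x, y⟩ hu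
    -- `T u` accepts the names of those `r` for which the section `{s | x ∈ BX r ∧ y ∈ BY s}` is
    -- nonempty. Some `s` satisfies `y ∈ BY s`, so this says `x ∈ BX r`.
    have h1 : NamesOpen (T u) {r | x ∈ (BX r).carrier} := by
      intro q r hq
      have : NamesOpen (W (merge u q)) {s | x ∈ (BX r).carrier ∧ y ∈ (BY s).carrier} :=
        fun q' s hq' => by
          rw [hWa]
          exact hu (merge q q') (r, s) (isName_merge_iff.2 ⟨hq, hq'⟩)
      rw [hTa, hSE _ _ this]
      exact ⟨fun h => (hcY y).imp fun s hs => ⟨h, hs⟩, fun ⟨s, hs⟩ => hs.1⟩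
    have h2 : NamesOpen (T' u) {s | y ∈ (BY s).carrier} := by
      intro q s hq
      have : NamesOpen (W' (merge u q)) {r | x ∈ (BX r).carrier ∧ y ∈ (BY s).carrier} :=
        fun q' r hq' => by
          rw [hWa']
          exact hu (merge q' q) (r, s) (isName_merge_iff.2 ⟨hq', hq⟩)
      rw [hTa', hRE _ _ this]
      exact ⟨fun h => (hcX x).imp fun r hr => ⟨hr, h⟩, fun ⟨r, hr⟩ => hr.2⟩
    obtain ⟨p, hp, hpG⟩ := hGBX _ _ h1
    obtain ⟨q, hq, hqG⟩ := hGBY _ _ h2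
    refine ⟨merge p q, isName_merge_iff.2 ⟨hp, hq⟩, fun n v => ?_⟩
    simp only [hpG, hqG, merge]
    split_ifs with h <;> simp [h]

/-- The intersection over `K` is the product of the intersections over its two projections, so the
product of the two overt sets works. It meets `O` iff `A₁` meets the open set of all `r` for which
`A₂` meets the section of `O` at `r`. -/
theorem isComputablePrebase_prodFamily {BX : R → OpenSets X} {BY : S → OpenSets Y}
    (hR : IsOvert R) (hS : IsOvert S) (hX : IsComputablePrebase BX) (hY : IsComputablePrebase BY) :
    IsComputablePrebase (prodFamily BX BY) := by
  obtain ⟨hX, ⟨QX, hQX, hQBX⟩, hcX⟩ := isComputablePrebase_iff.1 hX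
  obtain ⟨hY, ⟨QY, hQY, hQBY⟩, hcY⟩ := isComputablePrebase_iff.1 hY
  refine isComputablePrebase_iff.2
    ⟨isComputablePresubbase_prodFamily hR hS hX hcX hY hcY, ?_, fun z => ?_⟩
  swap
  · obtain ⟨r, hr⟩ := hcX z.1
    obtain ⟨s, hs⟩ := hcY z.2
    exact ⟨(r, s), hr, hs⟩
  have hE := (ComputableFunctional.id (α := Unit)).evens
  have hO := (ComputableFunctional.id (α := Unit)).odds
  obtain ⟨T₁, hT₁, hK₁⟩ := exists_namesSupersets_image_rel (α := Unit) (R := R × S) (S := R)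
    (ρ := fun _ t r => t.1 = r) (fun _ _ _ _ h h' => h.symm.trans h')
    (Semidecidable.accepts hE hO.evens) fun u U q t _ hu hq => by
      simp only [evens_merge, odds_merge, forall_eq']
      exact (hu _ _ hq.1).symm
  obtain ⟨T₂, hT₂, hK₂⟩ := exists_namesSupersets_image_rel (α := Unit) (R := R × S) (S := S)
    (ρ := fun _ t s => t.2 = s) (fun _ _ _ _ h h' => h.symm.trans h')
    (Semidecidable.accepts hE hO.odds) fun u U q t _ hu hq => by
      simp only [evens_merge, odds_merge, forall_eq']
      exact (hu _ _ hq.2).symm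
  obtain ⟨W, hW, hWa⟩ := exists_section
  have hV : SemidecidablePred fun d =>
      QY (merge (T₂ (evens (evens d)) ()) (W (merge (odds (evens d)) (odds d)))) :=
    hQY.subst ((hT₂.subst hE.evens Primrec.id).merge (hW.subst (hE.odds.merge hO) Primrec.id))
  obtain ⟨V, hV, hVa⟩ := hV.exists_accepts
  refine ⟨fun c => QX (merge (T₁ (evens c) ()) (V c)),
    hQX.subst ((hT₁.subst hE Primrec.id).merge hV), fun K k hK hk => ?_⟩
  obtain ⟨A₁, hA₁, hB₁⟩ := hQBX _ _ (hK₁ K k () hK hk).1 (hK₁ K k () hK hk).2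
  obtain ⟨A₂, hA₂, hB₂⟩ := hQBY _ _ (hK₂ K k () hK hk).1 (hK₂ K k () hK hk).2
  refine ⟨A₁ ×ˢ A₂, fun w O hw => ?_, fun z => ?_⟩
  · have h1 : NamesOpen (V (merge k w)) {r | ∃ s ∈ A₂, (r, s) ∈ O} := by
      intro q r hq
      have h2 : NamesOpen (W (merge w q)) {s | (r, s) ∈ O} := fun q' s hq' => by
        rw [hWa]
        exact hw (merge q q') (r, s) (isName_merge_iff.2 ⟨hq, hq'⟩)
      rw [hVa, evens_merge, evens_merge, odds_merge, odds_merge, ← hA₂ _ _ h2]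
      rfl
    simp only [evens_merge]
    rw [← hA₁ _ _ h1]
    constructor
    · rintro ⟨⟨r, s⟩, ⟨hr, hs⟩, h⟩
      exact ⟨r, hr, s, hs, h⟩
    · rintro ⟨r, hr, s, hs, h⟩
      exact ⟨(r, s), ⟨hr, hs⟩, h⟩
  · have h1 := hB₁ z.1
    have h2 := hB₂ z.2
    constructor
    · intro h
      obtain ⟨r, hr, hzr⟩ := h1.1 (by rintro _ ⟨t, ht, rfl⟩; exact (h t ht).1)
      obtain ⟨s, hs, hzs⟩ := h2.1 (by rintro _ ⟨t, ht, rfl⟩; exact (h t ht).2)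
      exact ⟨(r, s), ⟨hr, hs⟩, hzr, hzs⟩
    · rintro ⟨⟨r, s⟩, ⟨hr, hs⟩, hzr, hzs⟩ t ht
      exact ⟨h1.2 ⟨r, hr, hzr⟩ _ ⟨t, ht, rfl⟩, h2.2 ⟨s, hs, hzs⟩ _ ⟨t, ht, rfl⟩⟩

/-- The diagonal embedding, under which a meet looks like a subspace of the product. -/
theorem exists_meet_to_prod {Ω I J : Type*} (i : X ↪ Ω) (j : Y ↪ Ω) : ∃ e : Meet i j → X × Y,
    (∀ p z, IsName p z ↔ IsName p (e z)) ∧ ∀ (BX : I → OpenSets X) (BY : J → OpenSets Y) t z,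
      z ∈ (meetFamily i j BX BY t).carrier ↔ e z ∈ (prodFamily BX BY t).carrier := by
  choose x hx using fun z : Meet i j => z.2.1
  choose y hy using fun z : Meet i j => z.2.2
  refine ⟨fun z => (x z, y z), fun p z => ?_, fun BX BY t z => ?_⟩
  · constructor
    · rintro ⟨⟨x', hx', hp⟩, y', hy', hq⟩
      obtain rfl := i.injective (hx'.trans (hx z).symm)
      obtain rfl := j.injective (hy'.trans (hy z).symm)
      exact ⟨hp, hq⟩
    · rintro ⟨hp, hq⟩
      exact ⟨⟨_, hx z, hp⟩, _, hy z, hq⟩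
  · constructor
    · rintro ⟨⟨x', hx', hxz⟩, y', hy', hyz⟩
      obtain rfl := i.injective (hxz.trans (hx z).symm)
      obtain rfl := j.injective (hyz.trans (hy z).symm)
      exact ⟨hx', hy'⟩
    · rintro ⟨hp, hq⟩
      exact ⟨⟨_, hp, hx z⟩, _, hq, hy z⟩

end Products

/-! Coproducts -/

section Coproducts

variable {X Y R S : Type*} [RepresentedSpace X] [RepresentedSpace Y]

@[simp] theorem inl_mem_sumFamily_inl {BX : R → OpenSets X} {BY : S → OpenSets Y} {x : X} {r : R} :
    Sum.inl x ∈ (sumFamily BX BY (Sum.inl r)).carrier ↔ x ∈ (BX r).carrier := by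
  simp [sumFamily, OpenSets.inl]

@[simp] theorem inl_mem_sumFamily_inr {BX : R → OpenSets X} {BY : S → OpenSets Y} {x : X} {s : S} :
    Sum.inl x ∈ (sumFamily BX BY (Sum.inr s)).carrier ↔ False := by
  simp [sumFamily, OpenSets.inr]

@[simp] theorem inr_mem_sumFamily_inl {BX : R → OpenSets X} {BY : S → OpenSets Y} {y : Y} {r : R} :
    Sum.inr y ∈ (sumFamily BX BY (Sum.inl r)).carrier ↔ False := by
  simp [sumFamily, OpenSets.inl]

@[simp] theorem inr_mem_sumFamily_inr {BX : R → OpenSets X} {BY : S → OpenSets Y} {y : Y} {s : S} :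
    Sum.inr y ∈ (sumFamily BX BY (Sum.inr s)).carrier ↔ y ∈ (BY s).carrier := by
  simp [sumFamily, OpenSets.inr]

theorem isName_inl_iff {p : ℕ → ℕ} {x : X} :
    IsName p (Sum.inl x : X ⊕ Y) ↔ p 0 = 0 ∧ IsName (tail p) x := Iff.rfl

theorem isName_inr_iff {p : ℕ → ℕ} {y : Y} :
    IsName p (Sum.inr y : X ⊕ Y) ↔ p 0 = 1 ∧ IsName (tail p) y := Iff.rfl

theorem exists_accepts_cons (c : ℕ) :
    ∃ W : (ℕ → ℕ) → ℕ → ℕ, ComputableFunctional (fun p (_ : Unit) => W p) ∧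
    ∀ w q, Accepts (W w) q ↔ Accepts w (cons c q) := by
  have h : SemidecidablePred fun d => Accepts (evens d) (cons c (odds d)) :=
    Semidecidable.accepts ComputableFunctional.id.evens (ComputableFunctional.id.odds.cons c)
  obtain ⟨W, hW, h'⟩ := h.exists_accepts
  exact ⟨W, hW, fun w q => by simp [h']⟩

/-- Supplies names of the two summands as open subsets of a coproduct. -/
theorem exists_accepts_zero_eq (c : ℕ) :
    ∃ W : (ℕ → ℕ) → ℕ → ℕ, ComputableFunctional (fun p (_ : Unit) => W p) ∧
    ∀ w q, Accepts (W w) q ↔ q 0 = c := by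
  have h : SemidecidablePred fun d => odds d 0 = c :=
    Semidecidable.entry ComputableFunctional.id.odds (Primrec.const 0) (Primrec.const c)
  obtain ⟨W, hW, h'⟩ := h.exists_accepts
  exact ⟨W, hW, fun w q => by simp [h']⟩

theorem NamesOpen.preimage_inl {w w' : ℕ → ℕ} (h : ∀ q, Accepts w' q ↔ Accepts w (cons 0 q))
    {U : Set (X ⊕ Y)} (hU : NamesOpen w U) : NamesOpen w' (Sum.inl ⁻¹' U) := fun q x hq => by
  rw [h]
  exact hU (cons 0 q) (Sum.inl x) (isName_inl_iff.2 ⟨rfl, by rwa [tail_cons]⟩)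

theorem NamesOpen.preimage_inr {w w' : ℕ → ℕ} (h : ∀ q, Accepts w' q ↔ Accepts w (cons 1 q))
    {U : Set (X ⊕ Y)} (hU : NamesOpen w U) : NamesOpen w' (Sum.inr ⁻¹' U) := fun q x hq => by
  rw [h]
  exact hU (cons 1 q) (Sum.inr x) (isName_inr_iff.2 ⟨rfl, by rwa [tail_cons]⟩)

theorem isTopologicalBasis_sumFamily {BX : R → OpenSets X} {BY : S → OpenSets Y}
    (hX : @TopologicalSpace.IsTopologicalBasis X (finalTopology X) (range fun r => (BX r).carrier))
    (hY : @TopologicalSpace.IsTopologicalBasis Y (finalTopology Y) (range fun s => (BY s).carrier)) :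
    @TopologicalSpace.IsTopologicalBasis (X ⊕ Y) (finalTopology (X ⊕ Y))
      (range fun t => (sumFamily BX BY t).carrier) := by
  let _ := finalTopology X
  let _ := finalTopology Y
  refine @TopologicalSpace.isTopologicalBasis_of_isOpen_of_nhds _ (finalTopology (X ⊕ Y)) _ ?_ ?_
  · rintro _ ⟨t, rfl⟩
    exact (sumFamily BX BY t).isOpen
  · intro z U hz hU
    obtain ⟨u, hu⟩ := exists_namesOpen hU
    rcases z with x | y
    · obtain ⟨W, -, hW⟩ := exists_accepts_cons 0
      obtain ⟨_, ⟨r, rfl⟩, hx, hsub⟩ := hX.exists_subset_of_mem_open hz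
        (hu.preimage_inl (hW u)).isOpen
      refine ⟨_, ⟨Sum.inl r, rfl⟩, inl_mem_sumFamily_inl.2 hx, ?_⟩
      rintro (x' | y') h
      · exact hsub (inl_mem_sumFamily_inl.1 h)
      · exact (inr_mem_sumFamily_inl.1 h).elim
    · obtain ⟨W, -, hW⟩ := exists_accepts_cons 1
      obtain ⟨_, ⟨s, rfl⟩, hy, hsub⟩ := hY.exists_subset_of_mem_open hz
        (hu.preimage_inr (hW u)).isOpen
      refine ⟨_, ⟨Sum.inr s, rfl⟩, inr_mem_sumFamily_inr.2 hy, ?_⟩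
      rintro (x' | y') h
      · exact (inl_mem_sumFamily_inr.1 h).elim
      · exact hsub (inr_mem_sumFamily_inr.1 h)

variable [RepresentedSpace R] [RepresentedSpace S]

/-- The indices of sets containing a given point all lie in the summand matching the point, and some
exist by covering. So exactly one of the nonemptiness tests `ER`, `ES` succeeds; it supplies the
first entry of the name and selects the procedure for the rest. -/
theorem isComputablePresubbase_sumFamily {BX : R → OpenSets X} {BY : S → OpenSets Y}
    (hR : IsOvert R) (hS : IsOvert S) (hX : IsComputablePresubbase BX)
    (hcX : ∀ x, ∃ r, x ∈ (BX r).carrier) (hY : IsComputablePresubbase BY)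
    (hcY : ∀ y, ∃ s, y ∈ (BY s).carrier) : IsComputablePresubbase (sumFamily BX BY) := by
  obtain ⟨⟨PX, hPX, hPBX⟩, GX, hGX, hGBX⟩ := isComputablePresubbase_iff.1 hX
  obtain ⟨⟨PY, hPY, hPBY⟩, GY, hGY, hGBY⟩ := isComputablePresubbase_iff.1 hY
  obtain ⟨ER, hER, hRE⟩ := hR.exists_semidecidablePred
  obtain ⟨ES, hES, hSE⟩ := hS.exists_semidecidablePred
  obtain ⟨W, hW, hWa⟩ := exists_accepts_cons 0
  obtain ⟨W', hW', hWa'⟩ := exists_accepts_cons 1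
  have hE := (ComputableFunctional.id (α := Unit)).evens
  have hO := (ComputableFunctional.id (α := Unit)).odds
  refine isComputablePresubbase_iff.2
    ⟨⟨fun c => (evens c 0 = 0 ∧ odds c 0 = 0 ∧ PX (merge (tail (evens c)) (tail (odds c)))) ∨
      (evens c 0 = 1 ∧ odds c 0 = 1 ∧ PY (merge (tail (evens c)) (tail (odds c)))), ?_, ?_⟩,
    fun u b => (ER (W u) ∧ ((b.1 = 0 ∧ b.2 = 0) ∨ (¬ b.1 = 0 ∧ GX (W u) (b.1 - 1, b.2)))) ∨
      (ES (W' u) ∧ ((b.1 = 0 ∧ b.2 = 1) ∨ (¬ b.1 = 0 ∧ GY (W' u) (b.1 - 1, b.2)))), ?_, ?_⟩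
  · have h0 : ∀ c, Semidecidable fun p (_ : Unit) => evens p 0 = c := fun c =>
      Semidecidable.entry hE (Primrec.const 0) (Primrec.const c)
    have h1 : ∀ c, Semidecidable fun p (_ : Unit) => odds p 0 = c := fun c =>
      Semidecidable.entry hO (Primrec.const 0) (Primrec.const c)
    have h2 := hE.tail.merge hO.tail
    exact ((h0 0).and ((h1 0).and (hPX.subst h2))).or ((h0 1).and ((h1 1).and (hPY.subst h2)))
  · simp only [evens_merge, odds_merge]
    rintro p (x | y) q (r | s) hp hq
    · rw [isName_inl_iff] at hp hq
      simp [hp.1, hq.1, hPBX _ _ _ _ hp.2 hq.2]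
    · rw [isName_inl_iff] at hp
      rw [isName_inr_iff] at hq
      simp [hp.1, hq.1]
    · rw [isName_inr_iff] at hp
      rw [isName_inl_iff] at hq
      simp [hp.1, hq.1]
    · rw [isName_inr_iff] at hp hq
      simp [hp.1, hq.1, hPBY _ _ _ _ hp.2 hq.2]
  · have h0 : PrimrecPred fun b : ℕ × ℕ => b.1 = 0 := Primrec.eq.comp Primrec.fst (Primrec.const 0)
    have h1 : ∀ c, Semidecidable fun (_ : ℕ → ℕ) (b : ℕ × ℕ) => b.1 = 0 ∧ b.2 = c := fun c =>
      Semidecidable.primrec (h0.and (Primrec.eq.comp Primrec.snd (Primrec.const c)))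
    have hd : Primrec fun b : ℕ × ℕ => (b.1 - 1, b.2) :=
      (Primrec.pred.comp Primrec.fst).pair Primrec.snd
    have hW1 := hW.comp (Primrec.const () : Primrec fun _ : ℕ × ℕ => ())
    have hW2 := hW'.comp (Primrec.const () : Primrec fun _ : ℕ × ℕ => ())
    exact ((hER.subst hW1).and ((h1 0).or ((Semidecidable.primrec h0.not).and
      (hGX.subst hW1 hd)))).or ((hES.subst hW2).and ((h1 1).or ((Semidecidable.primrec h0.not).and
      (hGY.subst hW2 hd))))
  · intro u z hu
    have h1 := hRE _ _ (hu.preimage_inl (hWa u))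
    have h2 := hSE _ _ (hu.preimage_inr (hWa' u))
    rcases z with x | y
    · obtain ⟨p, hp, hpG⟩ := hGBX _ x (by simpa using hu.preimage_inl (hWa u))
      obtain ⟨r, hr⟩ := hcX x
      have h1' : ER (W u) := h1.2 ⟨r, (inl_mem_sumFamily_inl (BY := BY)).2 hr⟩
      have h2' : ¬ ES (W' u) := fun h => by
        obtain ⟨s, hs⟩ := h2.1 h
        exact (inl_mem_sumFamily_inr (BX := BX)).1 hs
      refine ⟨cons 0 p, isName_inl_iff.2 ⟨rfl, by rwa [tail_cons]⟩, fun n v => ?_⟩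
      simp only [h1', h2', true_and, false_and, or_false, hpG, cons]
      split_ifs with h <;> simp [h, eq_comm]
    · obtain ⟨p, hp, hpG⟩ := hGBY _ y (by simpa using hu.preimage_inr (hWa' u))
      obtain ⟨s, hs⟩ := hcY y
      have h2' : ES (W' u) := h2.2 ⟨s, (inr_mem_sumFamily_inr (BX := BX)).2 hs⟩
      have h1' : ¬ ER (W u) := fun h => by
        obtain ⟨r, hr⟩ := h1.1 h
        exact (inr_mem_sumFamily_inl (BY := BY)).1 hr
      refine ⟨cons 1 p, isName_inr_iff.2 ⟨rfl, by rwa [tail_cons]⟩, fun n v => ?_⟩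
      simp only [h1', h2', true_and, false_and, false_or, hpG, cons]
      split_ifs with h <;> simp [h, eq_comm]

theorem isComputablePrebase_sumFamily {BX : R → OpenSets X} {BY : S → OpenSets Y}
    (hR : IsOvert R) (hS : IsOvert S) (hX : IsComputablePrebase BX) (hY : IsComputablePrebase BY) :
    IsComputablePrebase (sumFamily BX BY) := by
  obtain ⟨hX, ⟨QX, hQX, hQBX⟩, hcX⟩ := isComputablePrebase_iff.1 hX
  obtain ⟨hY, ⟨QY, hQY, hQBY⟩, hcY⟩ := isComputablePrebase_iff.1 hY
  refine isComputablePrebase_iff.2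
    ⟨isComputablePresubbase_sumFamily hR hS hX hcX hY hcY, ?_, ?_⟩
  swap
  · rintro (x | y)
    · exact (hcX x).elim fun r hr => ⟨Sum.inl r, inl_mem_sumFamily_inl.2 hr⟩
    · exact (hcY y).elim fun s hs => ⟨Sum.inr s, inr_mem_sumFamily_inr.2 hs⟩
  have hE := (ComputableFunctional.id (α := Unit)).evens
  have hO := (ComputableFunctional.id (α := Unit)).odds
  have h0 : ∀ c, Semidecidable fun p (_ : Unit) => odds p 0 = c := fun c =>
    Semidecidable.entry hO (Primrec.const 0) (Primrec.const c)
  have h1 := Semidecidable.accepts hE hO.tail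
  -- The part of `K` in the first summand is its image under the partial inverse of `Sum.inl`;
  -- indices in the other summand satisfy the condition vacuously, whence the disjunct `h0 1`.
  obtain ⟨T₁, hT₁, hK₁⟩ := exists_namesSupersets_image_rel (α := Unit) (R := R ⊕ S) (S := R)
    (ρ := fun _ t r => t = Sum.inl r) (fun _ _ _ _ h h' => Sum.inl_injective (h.symm.trans h'))
    (((h0 0).and h1).or (h0 1)) <| by
      rintro u U q (r | s) _ hu hq
      · rw [isName_inl_iff] at hq
        simp [hq.1, hu _ _ hq.2]
      · rw [isName_inr_iff] at hq
        simp [hq.1]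
  obtain ⟨T₂, hT₂, hK₂⟩ := exists_namesSupersets_image_rel (α := Unit) (R := R ⊕ S) (S := S)
    (ρ := fun _ t s => t = Sum.inr s) (fun _ _ _ _ h h' => Sum.inr_injective (h.symm.trans h'))
    (((h0 1).and h1).or (h0 0)) <| by
      rintro u U q (r | s) _ hu hq
      · rw [isName_inl_iff] at hq
        simp [hq.1]
      · rw [isName_inr_iff] at hq
        simp [hq.1, hu _ _ hq.2]
  obtain ⟨W, hW, hWa⟩ := exists_accepts_cons 0
  obtain ⟨W', hW', hWa'⟩ := exists_accepts_cons 1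
  obtain ⟨N, hN, hNa⟩ := exists_accepts_zero_eq 0
  obtain ⟨N', hN', hNa'⟩ := exists_accepts_zero_eq 1
  have hNl : ∀ w, NamesOpen (N w) (range (Sum.inl : R → R ⊕ S)) := by
    rintro w q (r | s) hq
    · simp [hNa, (isName_inl_iff.1 hq).1]
    · simp [hNa, (isName_inr_iff.1 hq).1]
  have hNr : ∀ w, NamesOpen (N' w) (range (Sum.inr : S → R ⊕ S)) := by
    rintro w q (r | s) hq
    · simp [hNa', (isName_inl_iff.1 hq).1]
    · simp [hNa', (isName_inr_iff.1 hq).1]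
  refine ⟨fun c => (Accepts (evens c) (N c) ∧ QX (merge (T₁ (evens c) ()) (W (odds c)))) ∨
      (Accepts (evens c) (N' c) ∧ QY (merge (T₂ (evens c) ()) (W' (odds c)))), ?_,
    fun K k hK hk => ?_⟩
  · have hid : Primrec fun a : Unit => a := Primrec.id
    exact ((Semidecidable.accepts hE hN).and (hQX.subst ((hT₁.subst hE hid).merge
      (hW.subst hO hid)))).or ((Semidecidable.accepts hE hN').and
        (hQY.subst ((hT₂.subst hE hid).merge (hW'.subst hO hid))))
  obtain ⟨A₁, hA₁, hB₁⟩ := hQBX _ _ (hK₁ K k () hK hk).1 (hK₁ K k () hK hk).2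
  obtain ⟨A₂, hA₂, hB₂⟩ := hQBY _ _ (hK₂ K k () hK hk).1 (hK₂ K k () hK hk).2
  -- If `K` has indices in both summands, the intersection and this set are both empty; if `K` is
  -- empty, both halves are present and together cover the coproduct. The inclusions are
  -- semidecidable since the summands are open.
  refine ⟨{t | Sum.elim (fun r => K ⊆ range Sum.inl ∧ r ∈ A₁)
    (fun s => K ⊆ range Sum.inr ∧ s ∈ A₂) t}, fun w O hw => ?_, ?_⟩
  · simp only [evens_merge, odds_merge]
    rw [← hk _ _ (hNl _), ← hk _ _ (hNr _), ← hA₁ _ _ (hw.preimage_inl (hWa w)),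
      ← hA₂ _ _ (hw.preimage_inr (hWa' w))]
    constructor
    · rintro ⟨r | s, ⟨hK, ht⟩, hO⟩
      · exact Or.inl ⟨hK, r, ht, hO⟩
      · exact Or.inr ⟨hK, s, ht, hO⟩
    · rintro (⟨hK, r, ht, hO⟩ | ⟨hK, s, ht, hO⟩)
      · exact ⟨Sum.inl r, ⟨hK, ht⟩, hO⟩
      · exact ⟨Sum.inr s, ⟨hK, ht⟩, hO⟩
  · rintro (x | y)
    · constructor
      · intro h
        obtain ⟨r, hr, hx⟩ := (hB₁ x).1 (by
          rintro r ⟨_, ht, rfl⟩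
          exact inl_mem_sumFamily_inl.1 (h _ ht))
        refine ⟨Sum.inl r, ⟨?_, hr⟩, inl_mem_sumFamily_inl.2 hx⟩
        rintro (r' | s') ht
        · exact mem_range_self r'
        · exact (inl_mem_sumFamily_inr.1 (h _ ht)).elim
      · rintro ⟨r | s, ⟨hK, ht⟩, hO⟩ t htK
        · obtain ⟨r', rfl⟩ := hK htK
          exact inl_mem_sumFamily_inl.2
            ((hB₁ x).2 ⟨r, ht, inl_mem_sumFamily_inl.1 hO⟩ r' ⟨_, htK, rfl⟩)
        · exact (inl_mem_sumFamily_inr.1 hO).elim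
    · constructor
      · intro h
        obtain ⟨s, hs, hy⟩ := (hB₂ y).1 (by
          rintro s ⟨_, ht, rfl⟩
          exact inr_mem_sumFamily_inr.1 (h _ ht))
        refine ⟨Sum.inr s, ⟨?_, hs⟩, inr_mem_sumFamily_inr.2 hy⟩
        rintro (r' | s') ht
        · exact (inr_mem_sumFamily_inl.1 (h _ ht)).elim
        · exact mem_range_self s'
      · rintro ⟨r | s, ⟨hK, ht⟩, hO⟩ t htK
        · exact (inr_mem_sumFamily_inl.1 hO).elim
        · obtain ⟨s', rfl⟩ := hK htK
          exact inr_mem_sumFamily_inr.2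
            ((hB₂ y).2 ⟨s, ht, inr_mem_sumFamily_inr.1 hO⟩ s' ⟨_, htK, rfl⟩)

end Coproducts

/-! Countable powers -/

section Sequences

/-- The `i`-th column of a sequence. -/
def column (i : ℕ) (p : ℕ → ℕ) : ℕ → ℕ := fun k => p (Nat.pair i k)

/-- A name of the word `s :: l`, from a name `q` of `s` and a name `p` of `l`. -/
def consName (q p : ℕ → ℕ) : ℕ → ℕ := fun n =>
  if n = 0 then p 0 + 1 else if (n - 1).unpair.1 = 0 then q (n - 1).unpair.2
    else p (Nat.pair ((n - 1).unpair.1 - 1) (n - 1).unpair.2 + 1)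

theorem consName_zero (q p : ℕ → ℕ) : consName q p 0 = p 0 + 1 := rfl

theorem column_zero_tail_consName (q p : ℕ → ℕ) : column 0 (tail (consName q p)) = q := by
  funext k
  simp [column, tail, consName]

theorem column_succ_tail_consName (q p : ℕ → ℕ) (i : ℕ) :
    column (i + 1) (tail (consName q p)) = column i (tail p) := by
  funext k
  simp [column, tail, consName]

section

variable {α : Type*} [Primcodable α] {F G : (ℕ → ℕ) → α → ℕ → ℕ}

theorem ComputableFunctional.column (hF : ComputableFunctional F) {f : α → ℕ} (hf : Primrec f) :
    ComputableFunctional fun p a => column (f a) (F p a) :=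
  hF.reindex Primrec.fst (Primrec₂.natPair.comp (hf.comp Primrec.fst) Primrec.snd)

theorem ComputableFunctional.consName (hF : ComputableFunctional F)
    (hG : ComputableFunctional G) : ComputableFunctional fun p a => consName (F p a) (G p a) := by
  have h0 : ComputableFunctional fun p (_ : α) _ => p 0 + 1 :=
    ComputableFunctional.lookup (f := fun _ => 0) (g := fun x => x.2 + 1) (Primrec.const 0)
      (Primrec.succ.comp Primrec.snd)
  have hu : Primrec fun b : α × ℕ => (b.2 - 1).unpair :=
    Primrec.unpair.comp (Primrec.pred.comp Primrec.snd)
  refine ComputableFunctional.ite (c := fun b : α × ℕ => b.2 = 0)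
    (Primrec.eq.comp Primrec.snd (Primrec.const 0)) (h0.subst hG Primrec.id) ?_
  refine ComputableFunctional.ite (c := fun b : α × ℕ => (b.2 - 1).unpair.1 = 0)
    (Primrec.eq.comp (Primrec.fst.comp hu) (Primrec.const 0))
    (hF.reindex Primrec.fst (Primrec.snd.comp hu)) ?_
  exact hG.reindex Primrec.fst (Primrec.succ.comp (Primrec₂.natPair.comp
    (Primrec.pred.comp (Primrec.fst.comp hu)) (Primrec.snd.comp hu)))

theorem Semidecidable.entry_mem (hF : ComputableFunctional F) {f : α → ℕ} (hf : Primrec f)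
    {S : α × ℕ → Prop} (hS : PrimrecPred S) : Semidecidable fun p a => S (a, F p a (f a)) := by
  have h : Semidecidable fun p (b : α × ℕ) => F p b.1 (f b.1) = b.2 :=
    Semidecidable.entry (F := fun p (b : α × ℕ) => F p b.1) (hF.comp Primrec.fst)
      (hf.comp Primrec.fst) Primrec.snd
  exact (h.and (Semidecidable.primrec hS)).ex.of_eq fun p a => by simp

end

variable {Y S : Type*} [RepresentedSpace Y]

theorem mem_seqFamily {BY : S → OpenSets Y} {l : List S} {y : ℕ → Y} :
    y ∈ (seqFamily BY l).carrier ↔ ∀ i (hi : i < l.length), y i ∈ (BY l[i]).carrier := by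
  simp [seqFamily, OpenSets.cylinder]

theorem isName_seq_iff {p : ℕ → ℕ} {y : ℕ → Y} : IsName p y ↔ ∀ i, IsName (column i p) (y i) :=
  Iff.rfl

theorem isName_list_iff {p : ℕ → ℕ} {l : List Y} : IsName p l ↔ p 0 = l.length ∧
    ∀ (i : ℕ) (hi : i < l.length), IsName (column i (tail p)) l[i] := Iff.rfl

theorem isName_nil : IsName (fun _ => 0) ([] : List Y) :=
  isName_list_iff.2 ⟨rfl, fun _ hi => (Nat.not_lt_zero _ hi).elim⟩

theorem isName_consName {q p : ℕ → ℕ} {y : Y} {l : List Y} (hq : IsName q y) (hp : IsName p l) :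
    IsName (consName q p) (y :: l) := by
  refine isName_list_iff.2 ⟨by rw [consName_zero, hp.1]; rfl, fun i hi => ?_⟩
  rcases i with _ | i
  · rwa [column_zero_tail_consName]
  · rw [column_succ_tail_consName]
    exact hp.2 i (Nat.lt_of_succ_lt_succ hi)

variable [RepresentedSpace S]

/-- Existential quantification over the first `n` letters of a word, uniformly in `n`, where the
`i`-th letter ranges over a set for which existential quantification is semidecidable uniformly
in `i`. -/
theorem exists_iterated_projection {Q : (ℕ → ℕ) → ℕ → Prop} (hQ : Semidecidable Q) :
    ∃ W : (ℕ → ℕ) → ℕ → ℕ → ℕ, ComputableFunctional W ∧ ∀ (p : ℕ → ℕ) (A : ℕ → Set S),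
      (∀ i u U, NamesOpen u U → ((A i ∩ U).Nonempty ↔ Q (merge p u) i)) →
      ∀ (w : ℕ → ℕ) (O : Set (List S)), NamesOpen w O → ∀ n, NamesOpen (W (merge p w) n)
        {l | ∃ v : List S, v.length = n ∧ (∀ i (hi : i < v.length), v[i] ∈ A i) ∧ v ++ l ∈ O} := by
  have hE := (ComputableFunctional.id (α := Unit)).evens
  have hO := (ComputableFunctional.id (α := Unit)).odds
  -- `V'` computes a name of `{s | s :: l ∈ O}` from names of `O` and `l`.
  have h₁ : SemidecidablePred fun d => Accepts (evens (evens d))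
      (consName (odds d) (odds (evens d))) :=
    Semidecidable.accepts hE.evens (hO.consName hE.odds)
  obtain ⟨V', hV', hVa'⟩ := h₁.exists_accepts
  have hE' := (ComputableFunctional.id (α := ℕ)).evens
  have hO' := (ComputableFunctional.id (α := ℕ)).odds
  have h₂ : Semidecidable fun d (k : ℕ) =>
      Q (merge (evens (evens d)) (V' (merge (odds (evens d)) (odds d)))) k :=
    hQ.subst (hE'.evens.merge (hV'.subst (hE'.odds.merge hO') (Primrec.const ()))) Primrec.id
  obtain ⟨V, hV, hVa⟩ := h₂.exists_accepts
  have hF : ComputableFunctional fun c (k : ℕ) => merge (evens c) (V c k) := hE'.merge hV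
  -- The number of nested quantifiers depends on `n`, hence iteration. The state keeps the parameter
  -- `p` in its even half and the current open set of words in its odd half. Stage `n + 1` contains
  -- `l` iff `A n` meets `{s | s :: l is in stage n}`.
  refine ⟨_, hF.iterate.odds, fun p A hA w O hw n => ?_⟩
  set I : ℕ → ℕ → ℕ := fun n =>
    Nat.rec (merge p w) (fun k c => merge (evens c) (V c k)) n with hI
  have hI1 : ∀ n, I (n + 1) = merge (evens (I n)) (V (I n) n) := fun _ => rfl
  have hp : ∀ n, evens (I n) = p := by
    intro n
    induction n with
    | zero => exact evens_merge p w
    | succ n ih => rw [hI1, evens_merge, ih]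
  change NamesOpen (odds (I n)) _
  induction n with
  | zero =>
    have : odds (I 0) = w := odds_merge p w
    rw [this]
    convert hw using 1
    ext l
    constructor
    · rintro ⟨v, hv, -, h⟩
      obtain rfl := List.length_eq_zero_iff.1 hv
      exact h
    · exact fun h => ⟨[], rfl, by simp, h⟩
  | succ n ih =>
    rw [hI1, odds_merge]
    intro q l hq
    have h3 : NamesOpen (V' (merge (odds (I n)) q)) {s | ∃ v : List S, v.length = n ∧
        (∀ i (hi : i < v.length), v[i] ∈ A i) ∧ v ++ s :: l ∈ O} := fun q' s hq' => by
      rw [hVa', evens_merge, evens_merge, odds_merge, odds_merge]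
      exact ih (consName q' q) (s :: l) (isName_consName hq' hq)
    rw [hVa, evens_merge, odds_merge, hp, ← hA n _ _ h3]
    constructor
    · rintro ⟨v, hv, hvA, h⟩
      rcases List.eq_nil_or_concat v with rfl | ⟨v', s, rfl⟩
      · simp at hv
      obtain rfl : v'.length = n := by simpa using hv
      refine ⟨s, by simpa using hvA v'.length (by simp), v', rfl, fun i hi => ?_, by simpa using h⟩
      simpa [List.getElem_append_left hi] using hvA i (by simp; omega)
    · rintro ⟨s, hs, v, hv, hvA, h⟩
      refine ⟨v ++ [s], by simp [hv], fun i hi => ?_, by simpa using h⟩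
      rw [List.getElem_append]
      split_ifs with hin
      · exact hvA i hin
      · obtain rfl : i = n := by
          simp at hi
          omega
        simpa using hs

theorem isComputablePresubbase_seqFamily {BY : S → OpenSets Y} (hS : IsOvert S)
    (hY : IsComputablePresubbase BY) (hcY : ∀ y, ∃ s, y ∈ (BY s).carrier) :
    IsComputablePresubbase (seqFamily BY) := by
  obtain ⟨⟨PY, hPY, hPBY⟩, GY, hGY, hGBY⟩ := isComputablePresubbase_iff.1 hY
  obtain ⟨E, hE, hSE⟩ := hS.exists_semidecidablePred
  obtain ⟨W, hW, hWO⟩ := exists_iterated_projection (S := S)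
    (hE.subst (ComputableFunctional.id (α := ℕ)).odds)
  -- The zero sequence names the empty word, so this tests the one-letter word `[s]` after
  -- projecting away `i` preceding letters. The first copy of `evens c` only fills the parameter
  -- slot: the test `E` reads the open set alone.
  have hT : Semidecidable fun c (i : ℕ) =>
      Accepts (W (merge (evens c) (evens c)) i) (consName (odds c) fun _ => 0) := by
    have hev := (ComputableFunctional.id (α := ℕ)).evens
    exact Semidecidable.accepts (hW.subst (hev.merge hev) Primrec.id)
      (ComputableFunctional.id.odds.consName (ComputableFunctional.const (Primrec.const 0)))
  obtain ⟨T, hT, hTa⟩ := hT.exists_accepts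
  refine isComputablePresubbase_iff.2
    ⟨⟨fun c => ∃ n, odds c 0 = n ∧ ∀ i < n,
      PY (merge (column i (evens c)) (column i (tail (odds c)))), ?_, ?_⟩,
    fun u b => GY (T u b.1.unpair.1) (b.1.unpair.2, b.2), ?_, ?_⟩
  · have h1 : Semidecidable fun p (b : Unit × ℕ) => odds p 0 = b.2 :=
      Semidecidable.entry ComputableFunctional.id.odds (Primrec.const 0) Primrec.snd
    have hid := ComputableFunctional.id (α := (Unit × ℕ) × ℕ)
    have h2 : Semidecidable fun p (b : (Unit × ℕ) × ℕ) =>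
        PY (merge (column b.2 (evens p)) (column b.2 (tail (odds p)))) :=
      hPY.subst ((hid.evens.column Primrec.snd).merge (hid.odds.tail.column Primrec.snd))
    exact (h1.and (h2.forall_lt Primrec.snd)).ex
  · intro p y q l hp hq
    simp only [evens_merge, odds_merge, mem_seqFamily, hq.1, exists_eq_left']
    exact forall_congr' fun i => forall_congr' fun hi => hPBY _ _ _ _ (hp i) (hq.2 i hi)
  · have hu : Primrec fun b : ℕ × ℕ => b.1.unpair := Primrec.unpair.comp Primrec.fst
    exact hGY.subst (hT.comp (Primrec.fst.comp hu)) ((Primrec.snd.comp hu).pair Primrec.snd)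
  · intro u y hu
    -- By covering, `y i ∈ BY s` iff `y` lies in the cylinder of `v ++ [s]` for some word `v` of
    -- length `i`.
    have h : ∀ i, NamesOpen (T u i) {s | y i ∈ (BY s).carrier} := by
      intro i q s hq
      have h1 := hWO u (fun _ => univ) (fun i u' U hu' => by
        rw [univ_inter, odds_merge, hSE _ _ hu']) u _ hu i _ _ (isName_consName hq isName_nil)
      rw [hTa, evens_merge, odds_merge, ← h1]
      constructor
      · intro hs
        choose f hf using fun i => hcY (y i)
        refine ⟨(List.range i).map f, by simp, fun _ _ => mem_univ _, mem_seqFamily.2 ?_⟩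
        intro j hj
        rw [List.getElem_append]
        split_ifs with hji
        · simpa using hf j
        · obtain rfl : j = i := by
            simp at hj hji
            omega
          simpa using hs
      · rintro ⟨v, rfl, -, hv⟩
        simpa using mem_seqFamily.1 hv v.length (by simp)
    choose p hp hpG using fun i => hGBY _ _ (h i)
    refine ⟨fun m => p m.unpair.1 m.unpair.2, isName_seq_iff.2 fun i => ?_, fun n v => hpG _ _ _⟩
    convert hp i using 1
    funext k
    simp [column]

theorem isComputablePrebase_seqFamily {BY : S → OpenSets Y} (hS : IsOvert S)
    (hY : IsComputablePrebase BY) : IsComputablePrebase (seqFamily BY) := by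
  obtain ⟨hY, ⟨QY, hQY, hQBY⟩, hcY⟩ := isComputablePrebase_iff.1 hY
  refine isComputablePrebase_iff.2
    ⟨isComputablePresubbase_seqFamily hS hY hcY, ?_, fun y => ⟨[], mem_seqFamily.2 (by simp)⟩⟩
  have hev := (ComputableFunctional.id (α := ℕ)).evens
  have hod := (ComputableFunctional.id (α := ℕ)).odds
  -- The set of `i`-th letters of words in `K`, uniformly in `i`; words without an `i`-th letter
  -- impose no condition.
  obtain ⟨T, hT, hK⟩ := exists_namesSupersets_image_rel (R := List S) (S := S)
    (ρ := fun i l s => l[i]? = some s) (fun _ _ _ _ h h' => Option.some.inj (h.symm.trans h'))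
    (P := fun c i => odds c 0 ≤ i ∨ (i < odds c 0 ∧ Accepts (evens c) (column i (tail (odds c)))))
    ((Semidecidable.entry_mem (S := fun b : ℕ × ℕ => b.2 ≤ b.1) hod (Primrec.const 0)
      (Primrec.nat_le.comp Primrec.snd Primrec.fst)).or
      ((Semidecidable.entry_mem (S := fun b : ℕ × ℕ => b.1 < b.2) hod (Primrec.const 0)
      (Primrec.nat_lt.comp Primrec.fst Primrec.snd)).and
        (Semidecidable.accepts hev (hod.tail.column Primrec.id)))) <| by
      intro u U q l i hu hq
      simp only [evens_merge, odds_merge, hq.1]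
      rcases lt_or_ge i l.length with hi | hi
      · simp [hi, hi.not_ge, hu _ _ (hq.2 i hi)]
        exact Iff.rfl
      · simp [hi]
  have hN : Semidecidable fun c (n : ℕ) => odds c 0 ≤ n :=
    Semidecidable.entry_mem (S := fun b : ℕ × ℕ => b.2 ≤ b.1) hod (Primrec.const 0)
      (Primrec.nat_le.comp Primrec.snd Primrec.fst)
  obtain ⟨N, hN, hNa⟩ := hN.exists_accepts
  have hNl : ∀ p n, NamesOpen (N p n) {l : List S | l.length ≤ n} := fun p n q l hq => by
    rw [hNa, odds_merge, hq.1]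
    rfl
  obtain ⟨W, hW, hWO⟩ := exists_iterated_projection (S := S)
    (hQY.subst ((hT.subst hev Primrec.id).merge hod))
  refine ⟨fun c => ∃ n, Accepts (evens c) (N c n) ∧ Accepts (W c n) fun _ => 0, ?_,
    fun K k hcK hk => ?_⟩
  · have hs : Primrec fun b : Unit × ℕ => b.2 := Primrec.snd
    exact ((Semidecidable.accepts ComputableFunctional.id.evens (hN.comp hs)).and
      (Semidecidable.accepts (hW.comp hs) (ComputableFunctional.const (Primrec.const 0)))).ex
  choose A hA hB using fun i => hQBY _ _ (hK K k i hcK hk).1 (hK K k i hcK hk).2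
  -- Any upper bound for the lengths in `K` is allowed: beyond the longest word the `i`-th letters
  -- form the empty set, so the sets indexed by `A i` cover `Y` and the extra letters do no harm.
  refine ⟨{l | K ⊆ {l' | l'.length ≤ l.length} ∧ ∀ i (hi : i < l.length), l[i] ∈ A i},
    fun w O hw => ?_, fun y => ?_⟩
  · simp only [evens_merge]
    have h1 := fun n => hWO k A (fun i u U hu => by
      rw [hA i u U hu, evens_merge, odds_merge]
      rfl) w O hw n _ _ isName_nil
    simp only [← h1, ← hk _ _ (hNl _ _)]
    constructor
    · rintro ⟨l, ⟨hK, hl⟩, hO⟩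
      exact ⟨l.length, hK, l, rfl, hl, by simpa using hO⟩
    · rintro ⟨n, hK, l, rfl, hl, hO⟩
      exact ⟨l, ⟨hK, hl⟩, by simpa using hO⟩
  · simp only [mem_seqFamily]
    constructor
    · intro h
      -- The words of length at most `n` form an increasing open cover, so compactness bounds the
      -- lengths in `K`.
      have hn : ∃ n, K ⊆ {l : List S | l.length ≤ n} := by
        refine @IsCompact.elim_directed_cover _ (finalTopology (List S)) _ _ _ hcK
          (fun n => {l : List S | l.length ≤ n}) (fun n => (hNl k n).isOpen)
          (fun l _ => mem_iUnion.2 ⟨l.length, le_refl l.length⟩)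
          (Monotone.directed_le fun m n hmn l hl => le_trans hl hmn)
      obtain ⟨n, hn⟩ := hn
      have hs : ∀ i, ∃ s ∈ A i, y i ∈ (BY s).carrier := by
        refine fun i => (hB i (y i)).1 ?_
        rintro s ⟨l, hl, hs⟩
        obtain ⟨hi, rfl⟩ := List.getElem?_eq_some_iff.1 hs
        exact h l hl i hi
      choose f hfA hf using hs
      exact ⟨(List.range n).map f, ⟨by simpa using hn, by simpa using fun i _ => hfA i⟩,
        by simpa using fun i _ => hf i⟩
    · rintro ⟨l₀, ⟨hK, hl₀⟩, hy⟩ l hl i hi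
      have hi₀ : i < l₀.length := hi.trans_le (hK hl)
      exact (hB i (y i)).2 ⟨_, hl₀ i hi₀, hy i hi₀⟩ _ ⟨l, hl, List.getElem?_eq_getElem hi⟩

end Sequences

end RepresentedSpace

/-! ### Assembly of the five constructions -/

theorem proposition29 {X : Type*} {Y : Type*} {R : Type*} {S : Type*}
    [RepresentedSpace X] [RepresentedSpace Y] [RepresentedSpace R] [RepresentedSpace S]
    (BX : R → OpenSets X) (BY : S → OpenSets Y) :
    -- product
    (IsOvert R → IsOvert S →
      (IsComputablePresubbase BX → Covers BX → IsComputablePresubbase BY → Covers BY →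
        IsComputablePresubbase (prodFamily BX BY)) ∧
      (IsComputablePrebase BX → IsComputablePrebase BY →
        IsComputablePrebase (prodFamily BX BY))) ∧
    -- countable power
    (IsOvert S →
      (IsComputablePresubbase BY → Covers BY → IsComputablePresubbase (seqFamily BY)) ∧
      (IsComputablePrebase BY → IsComputablePrebase (seqFamily BY))) ∧
    -- subspace
    (∀ Z : Set X,
      (IsComputablePresubbase BX → IsComputablePresubbase (subspaceFamily BX Z)) ∧
      (IsComputablePrebase BX → IsComputablePrebase (subspaceFamily BX Z))) ∧
    -- coproduct
    (IsOvert R → IsOvert S →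
      (IsComputablePresubbase BX → Covers BX → IsComputablePresubbase BY → Covers BY →
        IsComputablePresubbase (sumFamily BX BY)) ∧
      (IsComputablePrebase BX → IsComputablePrebase BY →
        IsComputablePrebase (sumFamily BX BY)) ∧
      (IsComputableBase BX → IsComputableBase BY →
        IsComputableBase (sumFamily BX BY))) ∧
    -- meet
    (∀ {Ω : Type*} (i : X ↪ Ω) (j : Y ↪ Ω), IsOvert R → IsOvert S →
      (IsComputablePresubbase BX → Covers BX → IsComputablePresubbase BY → Covers BY →
        IsComputablePresubbase (meetFamily i j BX BY)) ∧
      (IsComputablePrebase BX → IsComputablePrebase BY →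
        IsComputablePrebase (meetFamily i j BX BY))) := by
  refine ⟨fun hR hS => ⟨fun hX hcX hY hcY => ?_, ?_⟩, fun hS => ⟨fun hY hcY => ?_, ?_⟩,
    fun Z => ⟨fun h => ?_, fun h => ?_⟩, fun hR hS => ⟨fun hX hcX hY hcY => ?_, ?_, ?_⟩,
    fun i j hR hS => ?_⟩
  · exact isComputablePresubbase_prodFamily hR hS hX hcX.exists_mem hY hcY.exists_mem
  · exact isComputablePrebase_prodFamily hR hS
  · exact isComputablePresubbase_seqFamily hS hY hcY.exists_mem
  · exact isComputablePrebase_seqFamily hS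
  · exact h.pullback (e := Subtype.val) (fun _ _ => Iff.rfl) fun _ _ => Iff.rfl
  · exact h.pullback (e := Subtype.val) (fun _ _ => Iff.rfl) fun _ _ => Iff.rfl
  · exact isComputablePresubbase_sumFamily hR hS hX hcX.exists_mem hY hcY.exists_mem
  · exact isComputablePrebase_sumFamily hR hS
  · exact fun hX hY => ⟨isComputablePrebase_sumFamily hR hS hX.1 hY.1,
      isTopologicalBasis_sumFamily hX.2 hY.2⟩
  · obtain ⟨e, he, hB⟩ := exists_meet_to_prod (I := R) (J := S) i j
    exact ⟨fun hX hcX hY hcY => (isComputablePresubbase_prodFamily hR hS hX hcX.exists_mem hY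
        hcY.exists_mem).pullback he (hB BX BY),
      fun hX hY => (isComputablePrebase_prodFamily hR hS hX hY).pullback he (hB BX BY)⟩
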